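/- Equip $\mathbb C^2$, with coordinates $(z,w)$, with the standard symplectic form $\omega=\frac i2(dz\wedge d\bar z+dw\wedge d\bar w)$. For real $a$ let $B(a)=\{(z,w)\in\mathbb C^2:\pi(|z|^2+|w|^2)<a\}$ be the open ball of capacity $a$, and for positive integers $k,l$ let $L(k,l)=\{(z,w)\in\mathbb C^2:\pi|z|^2=k,\ \pi|w|^2=l\}$. Let $R,a$ be real numbers with $3<R\le4$ and $a<R-1$. Then there exists a symplectic embedding $$B(a)\hookrightarrow B(R)\setminus\bigl(L(1,1)\cup L(1,2)\cup L(2,1)\bigr),$$ that is, a smooth embedding $f$ of $B(a)$ into this set with $f^*\omega=\omega$. -/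

import Mathlib

open scoped ContDiff

/-- The standard symplectic form `dx₁ ∧ dy₁ + dx₂ ∧ dy₂` on `ℂ²`, with coordinates `(z, w)`,
`z = x₁ + i y₁`, `w = x₂ + i y₂`, evaluated on a pair of tangent vectors. -/
def stdSymplecticForm (u v : ℂ × ℂ) : ℝ :=
  (u.1.re * v.1.im - u.1.im * v.1.re) + (u.2.re * v.2.im - u.2.im * v.2.re)

/-- The form above is `(i/2) (dz ∧ dz̄ + dw ∧ dw̄)`. -/
theorem stdSymplecticForm_eq (u v : ℂ × ℂ) :
    (stdSymplecticForm u v : ℂ) = Complex.I / 2 *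
      ((u.1 * starRingEnd ℂ v.1 - v.1 * starRingEnd ℂ u.1) +
        (u.2 * starRingEnd ℂ v.2 - v.2 * starRingEnd ℂ u.2)) := by
  apply Complex.ext <;> simp [stdSymplecticForm] <;> ring

/-- The open round ball `B(a) = {π (|z|² + |w|²) < a}` of capacity `a` in `ℂ²`. -/
def capacityBall (a : ℝ) : Set (ℂ × ℂ) :=
  {p | Real.pi * (‖p.1‖ ^ 2 + ‖p.2‖ ^ 2) < a}

/-- The product torus `L(k, l) = {π |z|² = k, π |w|² = l}` in `ℂ²`. -/
def productTorus (k l : ℝ) : Set (ℂ × ℂ) :=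
  {p | Real.pi * ‖p.1‖ ^ 2 = k ∧ Real.pi * ‖p.2‖ ^ 2 = l}

/-- `f`, restricted to the open set `V ⊆ ℂ²`, is a symplectic embedding of `V` into `U ⊆ ℂ²`:
it maps `V` into `U`, is smooth on `V`, is a homeomorphism of `V` onto its image, and pulls the
standard symplectic form back to itself at every point of `V` (in particular its differential
is injective there). The values of `f` outside `V` play no role. -/
structure IsSymplecticEmbeddingOn (f : ℂ × ℂ → ℂ × ℂ) (V U : Set (ℂ × ℂ)) : Prop where
  isOpen_source : IsOpen V
  mapsTo : Set.MapsTo f V U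
  contDiffOn : ContDiffOn ℝ ∞ f V
  isEmbedding : Topology.IsEmbedding (V.domRestrict f)
  preserves_form : ∀ p ∈ V, ∀ u v : ℂ × ℂ,
    stdSymplecticForm (fderiv ℝ f p u) (fderiv ℝ f p v) = stdSymplecticForm u v

/-!
After the dilation by `√π` the ball `{|z|² + |w|² < a}` has to be moved inside `{|z|² + |w|² < R}`,
`a + 1 < R`, off the three tori `{|z|² = k, |w|² = l}`. The embedding is explicit: it is composed of
maps `phaseMap γ μ : (z, w) ↦ (e^{iγ} z, μ)` with `γ` and `μ` depending on `(|z|², w)`. Such a map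
is a family of planar maps `μ`, parametrized by `X = |z|²`; it is symplectic when these preserve
area and `γ` compensates for their dependence on `X` (`isSympAt_phaseMap`), and it is injective when
they are.

The building block is `isoMap`. A disc `{|w|² < A}` is carried by an area-preserving map
`(ξ, η) ↦ (ξ / G'(η) + c(G(η)), G(η))` into the sector of angle `4π/3` of a disc `{|w|² < B}`,
where `B` is slightly larger than `3A/2` (`exists_sectorProfile`; only the areas of the slices
matter). A map in polar coordinates then expands the angle by almost `3/2` and turns `|w|²` into
`b + m |w|²`, `m` close to `2/3`. So the disc lands in the annulus `b < |w|² < b + mB`, of area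
close to that of the disc, slit along the positive real axis. The steps are switched on one after
the other as `X` varies. During the first two the image stays in `{|w|² < B}` and away from the far
part of the positive axis (`SectorProfile.mid`), and the last one acts on points of the sector only.

The first map (`exists_firstMap`) does this with `b = 1` for `X` in a small neighbourhood of `1`.
Then `|w|² > 1` where `|z|² = 1`, which avoids the torus `(1, 1)`, and `|z|² + |w|²` has grown by
little more than `1`. Since `a < 3`, a point of the image near the sphere `|z|² + |w|² = 3` has
`|z|²` close to `1`, and its `w` keeps away from the positive axis.

The second map (`levelMap`) acts near that sphere. In the chart `toReduced`, with `|u|² = |z|²` and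
`|ζ|² = |z|² + |w|²`, the other two tori are `{|u|² = 1, |ζ|² = 3}` and `{|u|² = 2, |ζ|² = 3}`, and
`u` is in a disc of area just above `π`. Now `isoMap` is applied to `u` with parameter `|ζ|²`. The
inner radius `b` is `1` at the level `|ζ|² = 3`, where `|u|² > 1` results, and just below `1` at the
level `3 - e`, where `|u|² < 2` results. Finally the level `3 - e` is lifted to the level `3` where
`|u|² ≥ 8/5` (`reducedBulge`), and left alone where `|u|² ≤ 7/5`. The new level `3` thus avoids both
tori (`ReducedData.reducedMap_spec`). The lift uses a branch of `arg (-ζ)`; this is harmless because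
`ζ` has the phase of `w` up to an angle controlled by `b'`, which can be made as small as desired.

Injectivity together with the inverse function theorem turns a pointwise symplectic map into an
embedding (`isSymplecticEmbeddingOn_of_isSympAt`).
-/

open Complex Topology

/-! ### Symplectic maps of `ℂ²` and maps fibred over `|z|²` -/

/-- The standard area form `dx ∧ dy` on `ℂ`. -/
def areaForm (u v : ℂ) : ℝ := u.re * v.im - u.im * v.re

theorem stdSymplecticForm_eq_areaForm (u v : ℂ × ℂ) :
    stdSymplecticForm u v = areaForm u.1 v.1 + areaForm u.2 v.2 := rfl

theorem stdSymplecticForm_nondegenerate {u : ℂ × ℂ} (h : ∀ v, stdSymplecticForm u v = 0) :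
    u = 0 := by
  have h1 := h (1, 0)
  have h2 := h (I, 0)
  have h3 := h (0, 1)
  have h4 := h (0, I)
  simp [stdSymplecticForm] at h1 h2 h3 h4
  exact Prod.ext (Complex.ext h2 h1) (Complex.ext h4 h3)

/-- `f` is smooth near `p` and its differential at `p` preserves the symplectic form. -/
def IsSympAt (f : ℂ × ℂ → ℂ × ℂ) (p : ℂ × ℂ) : Prop :=
  ContDiffAt ℝ ∞ f p ∧ ∀ u v : ℂ × ℂ,
    stdSymplecticForm (fderiv ℝ f p u) (fderiv ℝ f p v) = stdSymplecticForm u v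

theorem IsSympAt.differentiableAt {f : ℂ × ℂ → ℂ × ℂ} {p : ℂ × ℂ} (h : IsSympAt f p) :
    DifferentiableAt ℝ f p := h.1.differentiableAt (by simp)

theorem IsSympAt.comp {f g : ℂ × ℂ → ℂ × ℂ} {p : ℂ × ℂ} (hg : IsSympAt g (f p))
    (hf : IsSympAt f p) : IsSympAt (g ∘ f) p := by
  refine ⟨hg.1.comp p hf.1, fun u v => ?_⟩
  rw [fderiv_comp p hg.differentiableAt hf.differentiableAt]
  simp only [ContinuousLinearMap.comp_apply]
  rw [hg.2, hf.2]

theorem IsSympAt.congr {f g : ℂ × ℂ → ℂ × ℂ} {p : ℂ × ℂ} (hf : IsSympAt f p)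
    (h : g =ᶠ[𝓝 p] f) : IsSympAt g p :=
  ⟨hf.1.congr_of_eventuallyEq h, by rw [h.fderiv_eq]; exact hf.2⟩

theorem isSympAt_id (p : ℂ × ℂ) : IsSympAt id p :=
  ⟨contDiffAt_id, by simp⟩

theorem isSympAt_swap (p : ℂ × ℂ) : IsSympAt Prod.swap p := by
  have h : HasFDerivAt (Prod.swap : ℂ × ℂ → ℂ × ℂ)
      ((ContinuousLinearMap.snd ℝ ℂ ℂ).prod (ContinuousLinearMap.fst ℝ ℂ ℂ)) p :=
    ((ContinuousLinearMap.snd ℝ ℂ ℂ).prod (ContinuousLinearMap.fst ℝ ℂ ℂ)).hasFDerivAt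
  refine ⟨contDiff_snd.contDiffAt.prodMk contDiff_fst.contDiffAt, fun u v => ?_⟩
  rw [h.fderiv]
  simp [stdSymplecticForm]
  ring

theorem IsSympAt.map_nhds {f : ℂ × ℂ → ℂ × ℂ} {p : ℂ × ℂ} (h : IsSympAt f p) :
    Filter.map f (𝓝 p) = 𝓝 (f p) := by
  have hs : HasStrictFDerivAt f (fderiv ℝ f p) p := h.1.hasStrictFDerivAt (by simp)
  have hinj : Function.Injective (fderiv ℝ f p) := by
    rw [injective_iff_map_eq_zero]
    intro u hu
    refine stdSymplecticForm_nondegenerate fun v => ?_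
    rw [← h.2 u v, hu]
    simp [stdSymplecticForm]
  have hsurj : Function.Surjective (fderiv ℝ f p) :=
    (LinearMap.injective_iff_surjective (f := (fderiv ℝ f p : ℂ × ℂ →ₗ[ℝ] ℂ × ℂ))).1 hinj
  exact hs.map_nhds_eq_of_surj (LinearMap.range_eq_top.2 hsurj)

/-- An injective map that is pointwise a local symplectomorphism is a symplectic embedding: its
differentials are invertible, so the map is open. -/
theorem isSymplecticEmbeddingOn_of_isSympAt {f : ℂ × ℂ → ℂ × ℂ} {V U : Set (ℂ × ℂ)}
    (hV : IsOpen V) (hf : ∀ p ∈ V, IsSympAt f p) (hinj : Set.InjOn f V) (hm : Set.MapsTo f V U) :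
    IsSymplecticEmbeddingOn f V U where
  isOpen_source := hV
  mapsTo := hm
  contDiffOn := fun p hp => (hf p hp).1.contDiffWithinAt
  isEmbedding := by
    have hc : ContinuousOn f V := fun p hp => (hf p hp).1.continuousAt.continuousWithinAt
    refine (Topology.IsOpenEmbedding.of_continuous_injective_isOpenMap
      (continuousOn_iff_continuous_domRestrict.1 hc) ?_ ?_).isEmbedding
    · exact Set.injOn_iff_injective.1 hinj
    · rw [isOpenMap_iff_nhds_le]
      intro p
      have h1 : 𝓝 (f p) = Filter.map f (𝓝 (p : ℂ × ℂ)) := ((hf p p.2).map_nhds).symm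
      have h2 : Filter.map ((↑) : V → ℂ × ℂ) (𝓝 p) = 𝓝 (p : ℂ × ℂ) :=
        hV.isOpenEmbedding_subtypeVal.map_nhds_eq p
      change 𝓝 (f p) ≤ _
      rw [h1, ← h2, Filter.map_map]
      exact le_rfl
  preserves_form := fun p hp => (hf p hp).2

/-- The map `(z, w) ↦ (e^{iγ} z, μ)` with `γ`, `μ` functions of `(|z|², w)`: it preserves `|z|²`
and is equivariant under rotations of `z`. -/
noncomputable def phaseMap (γ : ℝ × ℂ → ℝ) (μ : ℝ × ℂ → ℂ) (p : ℂ × ℂ) : ℂ × ℂ :=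
  (cexp (γ (normSq p.1, p.2) * I) * p.1, μ (normSq p.1, p.2))

theorem normSq_phaseMap_fst (γ : ℝ × ℂ → ℝ) (μ : ℝ × ℂ → ℂ) (p : ℂ × ℂ) :
    normSq (phaseMap γ μ p).1 = normSq p.1 := by
  simp [phaseMap, normSq_eq_norm_sq, Complex.norm_exp_ofReal_mul_I]

/-- `phaseMap γ μ` is symplectic as soon as `½ dX ∧ dγ + μ^* ω = ω` in the variables `(X, w)`. -/
theorem isSympAt_phaseMap {γ : ℝ × ℂ → ℝ} {μ : ℝ × ℂ → ℂ} {p : ℂ × ℂ}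
    {γ' : ℝ × ℂ →L[ℝ] ℝ} {μ' : ℝ × ℂ →L[ℝ] ℂ}
    (hγ : ContDiffAt ℝ ∞ γ (normSq p.1, p.2)) (hμ : ContDiffAt ℝ ∞ μ (normSq p.1, p.2))
    (hγ' : HasFDerivAt γ γ' (normSq p.1, p.2)) (hμ' : HasFDerivAt μ μ' (normSq p.1, p.2))
    (h : ∀ u v : ℝ × ℂ, areaForm (μ' u) (μ' v) + (u.1 * γ' v - v.1 * γ' u) / 2 =
      areaForm u.2 v.2) :
    IsSympAt (phaseMap γ μ) p := by
  have hns : ∀ q : ℂ × ℂ, (normSq q.1, q.2) = (q.1.re ^ 2 + q.1.im ^ 2, q.2) := by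
    intro q; simp [normSq_apply]; ring
  have hjc : ContDiff ℝ ∞ (fun q : ℂ × ℂ => (normSq q.1, q.2)) := by
    simp only [hns]
    have h1 : ContDiff ℝ ∞ (fun q : ℂ × ℂ => q.1.re) := reCLM.contDiff.comp contDiff_fst
    have h2 : ContDiff ℝ ∞ (fun q : ℂ × ℂ => q.1.im) := imCLM.contDiff.comp contDiff_fst
    exact ((h1.pow 2).add (h2.pow 2)).prodMk contDiff_snd
  have hjd : HasFDerivAt (fun q : ℂ × ℂ => (normSq q.1, q.2))
      (((2 * p.1.re) • (reCLM.comp (ContinuousLinearMap.fst ℝ ℂ ℂ)) +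
        (2 * p.1.im) • (imCLM.comp (ContinuousLinearMap.fst ℝ ℂ ℂ))).prod
          (ContinuousLinearMap.snd ℝ ℂ ℂ)) p := by
    simp only [hns]
    refine HasFDerivAt.prodMk ?_ hasFDerivAt_snd
    have h1 : HasFDerivAt (fun q : ℂ × ℂ => q.1.re) (reCLM.comp (ContinuousLinearMap.fst ℝ ℂ ℂ)) p :=
      (reCLM.comp (ContinuousLinearMap.fst ℝ ℂ ℂ)).hasFDerivAt
    have h2 : HasFDerivAt (fun q : ℂ × ℂ => q.1.im) (imCLM.comp (ContinuousLinearMap.fst ℝ ℂ ℂ)) p :=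
      (imCLM.comp (ContinuousLinearMap.fst ℝ ℂ ℂ)).hasFDerivAt
    refine HasFDerivAt.congr_fderiv ((h1.pow 2).add (h2.pow 2)) ?_
    norm_num [nsmul_eq_mul]
  set J := (((2 * p.1.re) • (reCLM.comp (ContinuousLinearMap.fst ℝ ℂ ℂ)) +
        (2 * p.1.im) • (imCLM.comp (ContinuousLinearMap.fst ℝ ℂ ℂ))).prod
          (ContinuousLinearMap.snd ℝ ℂ ℂ)) with hJ
  have hJa : ∀ h, J h = (2 * (p.1.re * h.1.re + p.1.im * h.1.im), h.2) := by
    intro h; simp [hJ]; ring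
  have hg1 : HasFDerivAt (fun q : ℂ × ℂ => γ (normSq q.1, q.2)) (γ'.comp J) p :=
    HasFDerivAt.comp p hγ' hjd
  have hm1 : HasFDerivAt (fun q : ℂ × ℂ => μ (normSq q.1, q.2)) (μ'.comp J) p :=
    HasFDerivAt.comp p hμ' hjd
  have hgc : ContDiffAt ℝ ∞ (fun q : ℂ × ℂ => γ (normSq q.1, q.2)) p :=
    ContDiffAt.comp p hγ hjc.contDiffAt
  have hmc : ContDiffAt ℝ ∞ (fun q : ℂ × ℂ => μ (normSq q.1, q.2)) p :=
    ContDiffAt.comp p hμ hjc.contDiffAt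
  have hgI : HasFDerivAt (fun q : ℂ × ℂ => (γ (normSq q.1, q.2) : ℂ) * I)
      (I • (ofRealCLM.comp (γ'.comp J))) p := by
    have := (ofRealCLM.hasFDerivAt.comp p hg1).mul_const I
    exact this
  have hd := (hgI.cexp.mul (hasFDerivAt_fst (p := p))).prodMk hm1
  have hgIc : ContDiffAt ℝ ∞ (fun q : ℂ × ℂ => (γ (normSq q.1, q.2) : ℂ) * I) p :=
    (ofRealCLM.contDiff.contDiffAt.comp p hgc).mul contDiffAt_const
  refine ⟨(hgIc.cexp.mul contDiffAt_fst).prodMk hmc, fun u v => ?_⟩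
  have hf : fderiv ℝ (phaseMap γ μ) p = _ := hd.fderiv
  rw [hf]
  set g := γ (normSq p.1, p.2)
  have h0 := h (J u) (J v)
  have e2 : areaForm (J u).2 (J v).2 = areaForm u.2 v.2 := by rw [hJa, hJa]
  rw [e2] at h0
  rw [stdSymplecticForm_eq_areaForm, stdSymplecticForm_eq_areaForm, ← h0]
  have hu1 : (J u).1 = 2 * (p.1.re * u.1.re + p.1.im * u.1.im) := by rw [hJa]
  have hv1 : (J v).1 = 2 * (p.1.re * v.1.re + p.1.im * v.1.im) := by rw [hJa]
  rw [hu1, hv1]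
  simp [areaForm, exp_re, exp_im]
  set a := γ' (J u)
  set b := γ' (J v)
  have hcs := Real.sin_sq_add_cos_sq g
  generalize Real.cos g = C at *
  generalize Real.sin g = S at *
  linear_combination (u.1.re * v.1.im - u.1.im * v.1.re + b * (p.1.re * u.1.re + p.1.im * u.1.im) -
    a * (p.1.re * v.1.re + p.1.im * v.1.im)) * hcs

/-- A phase map is injective on a set when its second component is injective on the slices
`|z|² = const`. -/
theorem injOn_phaseMap {γ : ℝ × ℂ → ℝ} {μ : ℝ × ℂ → ℂ} {s : Set (ℂ × ℂ)}
    (h : ∀ p ∈ s, ∀ q ∈ s, normSq p.1 = normSq q.1 →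
      μ (normSq p.1, p.2) = μ (normSq p.1, q.2) → p.2 = q.2) :
    Set.InjOn (phaseMap γ μ) s := by
  intro p hp q hq hpq
  have h1 : normSq p.1 = normSq q.1 := by
    rw [← normSq_phaseMap_fst γ μ p, hpq, normSq_phaseMap_fst]
  have h2 : p.2 = q.2 := by
    refine h p hp q hq h1 ?_
    have := congrArg Prod.snd hpq
    simpa [phaseMap, h1] using this
  have h3 := congrArg Prod.fst hpq
  simp only [phaseMap, h1, h2] at h3
  exact Prod.ext (mul_left_cancel₀ (Complex.exp_ne_zero _) h3) h2

/-! ### Stretches, shears and polar maps -/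

theorem contDiff_deriv_of_infty {f : ℝ → ℝ} (hf : ContDiff ℝ ∞ f) : ContDiff ℝ ∞ (deriv f) :=
  (contDiff_infty_iff_deriv.1 hf).2

theorem hasDerivAt_of_infty {f : ℝ → ℝ} (hf : ContDiff ℝ ∞ f) (x : ℝ) :
    HasDerivAt f (deriv f x) x :=
  (hf.differentiable (by simp) x).hasDerivAt

/-- `isSympAt_phaseMap` for a planar component given by its real and imaginary parts. -/
theorem isSympAt_phaseMap_re_im {γ α β : ℝ × ℂ → ℝ} {p : ℂ × ℂ}
    {γ' α' β' : ℝ × ℂ →L[ℝ] ℝ}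
    (hγ : ContDiffAt ℝ ∞ γ (normSq p.1, p.2)) (hα : ContDiffAt ℝ ∞ α (normSq p.1, p.2))
    (hβ : ContDiffAt ℝ ∞ β (normSq p.1, p.2))
    (hγ' : HasFDerivAt γ γ' (normSq p.1, p.2)) (hα' : HasFDerivAt α α' (normSq p.1, p.2))
    (hβ' : HasFDerivAt β β' (normSq p.1, p.2))
    (h : ∀ u v : ℝ × ℂ, α' u * β' v - β' u * α' v + (u.1 * γ' v - v.1 * γ' u) / 2 =
      areaForm u.2 v.2) :
    IsSympAt (phaseMap γ (fun q => (α q : ℂ) + (β q : ℂ) * I)) p := by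
  refine isSympAt_phaseMap hγ ((ofRealCLM.contDiff.contDiffAt.comp _ hα).add
    ((ofRealCLM.contDiff.contDiffAt.comp _ hβ).mul (contDiffAt_const (c := I)))) hγ'
    ((ofRealCLM.hasFDerivAt.comp _ hα').add
      ((ofRealCLM.hasFDerivAt.comp _ hβ').mul_const I)) fun u v => ?_
  rw [← h]
  simp [areaForm]

/-- `isSympAt_phaseMap` for a planar component written as `w exp (L + iφ)`, `w ≠ 0`. -/
theorem isSympAt_phaseMap_exp {γ L φ : ℝ × ℂ → ℝ} {p : ℂ × ℂ}
    {γ' L' φ' : ℝ × ℂ →L[ℝ] ℝ} (hw : p.2 ≠ 0)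
    (hγ : ContDiffAt ℝ ∞ γ (normSq p.1, p.2)) (hL : ContDiffAt ℝ ∞ L (normSq p.1, p.2))
    (hφ : ContDiffAt ℝ ∞ φ (normSq p.1, p.2))
    (hγ' : HasFDerivAt γ γ' (normSq p.1, p.2)) (hL' : HasFDerivAt L L' (normSq p.1, p.2))
    (hφ' : HasFDerivAt φ φ' (normSq p.1, p.2))
    (h : ∀ u v : ℝ × ℂ, normSq p.2 * Real.exp (2 * L (normSq p.1, p.2)) *
        ((L' u + (p.2.re * u.2.re + p.2.im * u.2.im) / normSq p.2) *
          (φ' v + (p.2.re * v.2.im - p.2.im * v.2.re) / normSq p.2) -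
        (φ' u + (p.2.re * u.2.im - p.2.im * u.2.re) / normSq p.2) *
          (L' v + (p.2.re * v.2.re + p.2.im * v.2.im) / normSq p.2)) +
      (u.1 * γ' v - v.1 * γ' u) / 2 = areaForm u.2 v.2) :
    IsSympAt (phaseMap γ (fun q => q.2 * cexp ((L q : ℂ) + (φ q : ℂ) * I))) p := by
  refine isSympAt_phaseMap hγ (contDiffAt_snd.mul
    ((ofRealCLM.contDiff.contDiffAt.comp _ hL).add
    ((ofRealCLM.contDiff.contDiffAt.comp _ hφ).mul (contDiffAt_const (c := I)))).cexp) hγ'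
    (hasFDerivAt_snd.mul ((ofRealCLM.hasFDerivAt.comp _ hL').add
      ((ofRealCLM.hasFDerivAt.comp _ hφ').mul_const I)).cexp) fun u v => ?_
  rw [← h]
  congr 1
  have hY : normSq p.2 ≠ 0 := by simpa using hw
  have hY2 : normSq p.2 = p.2.re * p.2.re + p.2.im * p.2.im := normSq_apply _
  have hE : Real.exp (2 * L (normSq p.1, p.2)) = Real.exp (L (normSq p.1, p.2)) ^ 2 := by
    rw [← Real.exp_nat_mul]; norm_num
  simp [areaForm, exp_re, exp_im]
  rw [hE]
  have hcs := Real.sin_sq_add_cos_sq (φ (normSq p.1, p.2))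
  generalize Real.sin (φ (normSq p.1, p.2)) = S at *
  generalize Real.cos (φ (normSq p.1, p.2)) = C at *
  generalize Real.exp (L (normSq p.1, p.2)) = E at *
  generalize L' u = a
  generalize L' v = b
  generalize φ' u = d
  generalize φ' v = e
  generalize normSq p.2 = Y at *
  generalize p.2.re = m at *
  generalize p.2.im = n at *
  generalize u.2.re = ur
  generalize u.2.im = ui
  generalize v.2.re = vr
  generalize v.2.im = vi
  field_simp
  subst hY2
  linear_combination E ^ 2 * (m * m + n * n) * ((a * m - d * n + ur) * (b * n + e * m + vi) -
    (a * n + d * m + ui) * (b * m - e * n + vr)) * hcs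

/-- The lift to `ℂ²` of the family of maps `ξ + iη ↦ ξ / (1 + t r'(η)) + i (η + t r(η))`,
with parameter `t = t(|z|²)`. For fixed `|z|²` it is the cotangent lift of the map
`η ↦ η + t r(η)` of the line, hence preserves area. -/
noncomputable def stretchMap (t r : ℝ → ℝ) : ℂ × ℂ → ℂ × ℂ :=
  phaseMap
    (fun q => 2 * q.2.re * (deriv t q.1 * r q.2.im) / (1 + t q.1 * deriv r q.2.im))
    (fun q => ((q.2.re / (1 + t q.1 * deriv r q.2.im) : ℝ) : ℂ) +
      ((q.2.im + t q.1 * r q.2.im : ℝ) : ℂ) * I)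

theorem isSympAt_stretchMap {t r : ℝ → ℝ} (ht : ContDiff ℝ ∞ t) (hr : ContDiff ℝ ∞ r)
    (p : ℂ × ℂ) (h0 : 1 + t (normSq p.1) * deriv r p.2.im ≠ 0) :
    IsSympAt (stretchMap t r) p := by
  have ht' := contDiff_deriv_of_infty ht
  have hr' := contDiff_deriv_of_infty hr
  set X := normSq p.1
  have hX : HasFDerivAt (fun q : ℝ × ℂ => q.1) (ContinuousLinearMap.fst ℝ ℝ ℂ) (X, p.2) :=
    hasFDerivAt_fst
  have hξ : HasFDerivAt (fun q : ℝ × ℂ => q.2.re)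
      (reCLM.comp (ContinuousLinearMap.snd ℝ ℝ ℂ)) (X, p.2) :=
    (reCLM.comp (ContinuousLinearMap.snd ℝ ℝ ℂ)).hasFDerivAt
  have hη : HasFDerivAt (fun q : ℝ × ℂ => q.2.im)
      (imCLM.comp (ContinuousLinearMap.snd ℝ ℝ ℂ)) (X, p.2) :=
    (imCLM.comp (ContinuousLinearMap.snd ℝ ℝ ℂ)).hasFDerivAt
  have cX : ContDiffAt ℝ ∞ (fun q : ℝ × ℂ => q.1) (X, p.2) := contDiffAt_fst
  have cξ : ContDiffAt ℝ ∞ (fun q : ℝ × ℂ => q.2.re) (X, p.2) :=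
    reCLM.contDiff.contDiffAt.comp _ contDiffAt_snd
  have cη : ContDiffAt ℝ ∞ (fun q : ℝ × ℂ => q.2.im) (X, p.2) :=
    imCLM.contDiff.contDiffAt.comp _ contDiffAt_snd
  have dt := (hasDerivAt_of_infty ht X).comp_hasFDerivAt (X, p.2) hX
  have dt' := (hasDerivAt_of_infty ht' X).comp_hasFDerivAt (X, p.2) hX
  have dr := (hasDerivAt_of_infty hr p.2.im).comp_hasFDerivAt (X, p.2) hη
  have dr' := (hasDerivAt_of_infty hr' p.2.im).comp_hasFDerivAt (X, p.2) hη
  have ct := ht.contDiffAt.comp (X, p.2) cX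
  have ct' := ht'.contDiffAt.comp (X, p.2) cX
  have cr := hr.contDiffAt.comp (X, p.2) cη
  have cr' := hr'.contDiffAt.comp (X, p.2) cη
  have cg : ContDiffAt ℝ ∞ (fun q : ℝ × ℂ => 1 + t q.1 * deriv r q.2.im) (X, p.2) :=
    contDiffAt_const.add (ct.mul cr')
  have dg := ((dt.mul dr').const_add 1)
  have di := (hasDerivAt_inv h0).comp_hasFDerivAt (X, p.2) dg
  have ci := cg.inv h0
  have dγ := (((hξ.const_mul 2).mul (dt'.mul dr)).mul di)
  have cγ := (((contDiffAt_const (c := (2 : ℝ))).mul cξ).mul (ct'.mul cr)).mul ci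
  refine isSympAt_phaseMap_re_im cγ (cξ.mul ci) (cη.add (ct.mul cr)) dγ (hξ.mul di)
    (hη.add (dt.mul dr)) fun u v => ?_
  simp [areaForm]
  generalize hD : 1 + t X * deriv r p.2.im = D at *
  field_simp
  rw [← hD]
  ring

/-- The lift to `ℂ²` of the family of shears `ξ + iη ↦ ξ + t C'(η) + iη`, with parameter
`t = t(|z|²)`: the time-one map of the Hamiltonian `t(|z|²) C(Im w)`, up to sign. -/
noncomputable def shearMap (t C : ℝ → ℝ) : ℂ × ℂ → ℂ × ℂ :=
  phaseMap (fun q => -2 * (deriv t q.1 * C q.2.im))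
    (fun q => q.2 + ((t q.1 * deriv C q.2.im : ℝ) : ℂ))

theorem isSympAt_shearMap {t C : ℝ → ℝ} (ht : ContDiff ℝ ∞ t) (hC : ContDiff ℝ ∞ C)
    (p : ℂ × ℂ) : IsSympAt (shearMap t C) p := by
  have ht' := contDiff_deriv_of_infty ht
  have hC' := contDiff_deriv_of_infty hC
  set X := normSq p.1
  have hX : HasFDerivAt (fun q : ℝ × ℂ => q.1) (ContinuousLinearMap.fst ℝ ℝ ℂ) (X, p.2) :=
    hasFDerivAt_fst
  have hη : HasFDerivAt (fun q : ℝ × ℂ => q.2.im)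
      (imCLM.comp (ContinuousLinearMap.snd ℝ ℝ ℂ)) (X, p.2) :=
    (imCLM.comp (ContinuousLinearMap.snd ℝ ℝ ℂ)).hasFDerivAt
  have cX : ContDiffAt ℝ ∞ (fun q : ℝ × ℂ => q.1) (X, p.2) := contDiffAt_fst
  have cη : ContDiffAt ℝ ∞ (fun q : ℝ × ℂ => q.2.im) (X, p.2) :=
    imCLM.contDiff.contDiffAt.comp _ contDiffAt_snd
  have dt := (hasDerivAt_of_infty ht X).comp_hasFDerivAt (X, p.2) hX
  have dt' := (hasDerivAt_of_infty ht' X).comp_hasFDerivAt (X, p.2) hX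
  have dC := (hasDerivAt_of_infty hC p.2.im).comp_hasFDerivAt (X, p.2) hη
  have dC' := (hasDerivAt_of_infty hC' p.2.im).comp_hasFDerivAt (X, p.2) hη
  have ct := ht.contDiffAt.comp (X, p.2) cX
  have ct' := ht'.contDiffAt.comp (X, p.2) cX
  have cC := hC.contDiffAt.comp (X, p.2) cη
  have cC' := hC'.contDiffAt.comp (X, p.2) cη
  have dγ := (dt'.mul dC).const_mul (-2)
  have cγ := (contDiffAt_const (c := (-2 : ℝ))).mul (ct'.mul cC)
  have dμ := (hasFDerivAt_snd (p := (X, p.2)) (𝕜 := ℝ)).add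
    (ofRealCLM.hasFDerivAt.comp (X, p.2) (dt.mul dC'))
  have cμ := (contDiffAt_snd (𝕜 := ℝ) (n := ∞) (p := (X, p.2))).add
    (ofRealCLM.contDiff.contDiffAt.comp (X, p.2) (ct.mul cC'))
  refine isSympAt_phaseMap cγ cμ dγ dμ ?_
  intro u v
  simp [areaForm]
  ring

/-- The lift to `ℂ²` of the family of maps `(Y, θ) ↦ (g, θ / g_Y)`, where `Y = |w|²`,
`g = Y + p(X) r(Y) + s(X)` and the parameter is `X = |z|²`. Here `θ` is a branch of the argument of
`w`, up to an additive constant, so that `w` is sent to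
`w (g / Y)^{1/2} exp (i (θ / g_Y - θ))`. -/
noncomputable def polarMapOf (θ : ℂ → ℝ) (p r s : ℝ → ℝ) : ℂ × ℂ → ℂ × ℂ :=
  phaseMap
    (fun q => -(θ q.2 * (deriv p q.1 * r (normSq q.2) + deriv s q.1) *
      (1 + p q.1 * deriv r (normSq q.2))⁻¹))
    (fun q => q.2 * cexp (((1 / 2 * (Real.log (normSq q.2 + p q.1 * r (normSq q.2) + s q.1) -
      Real.log (normSq q.2)) : ℝ) : ℂ) +
        ((θ q.2 * (1 + p q.1 * deriv r (normSq q.2))⁻¹ - θ q.2 : ℝ) : ℂ) * I))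

theorem isSympAt_polarMapOf {θ : ℂ → ℝ} {p r s : ℝ → ℝ} (hp : ContDiff ℝ ∞ p)
    (hr : ContDiff ℝ ∞ r) (hs : ContDiff ℝ ∞ s) (x : ℂ × ℂ)
    (hθc : ContDiffAt ℝ ∞ θ x.2)
    (hθ : HasFDerivAt θ ((normSq x.2)⁻¹ • (x.2.re • imCLM - x.2.im • reCLM)) x.2)
    (hY : x.2 ≠ 0)
    (hg : 0 < normSq x.2 + p (normSq x.1) * r (normSq x.2) + s (normSq x.1))
    (hgY : 1 + p (normSq x.1) * deriv r (normSq x.2) ≠ 0) :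
    IsSympAt (polarMapOf θ p r s) x := by
  obtain ⟨z, w⟩ := x
  simp only at *
  have hp' := contDiff_deriv_of_infty hp
  have hr' := contDiff_deriv_of_infty hr
  have hs' := contDiff_deriv_of_infty hs
  set X := normSq z
  have hY0 : normSq w ≠ 0 := by simpa using hY
  have hX : HasFDerivAt (fun q : ℝ × ℂ => q.1) (ContinuousLinearMap.fst ℝ ℝ ℂ) (X, w) :=
    hasFDerivAt_fst
  have hξ : HasFDerivAt (fun q : ℝ × ℂ => q.2.re)
      (reCLM.comp (ContinuousLinearMap.snd ℝ ℝ ℂ)) (X, w) :=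
    (reCLM.comp (ContinuousLinearMap.snd ℝ ℝ ℂ)).hasFDerivAt
  have hη : HasFDerivAt (fun q : ℝ × ℂ => q.2.im)
      (imCLM.comp (ContinuousLinearMap.snd ℝ ℝ ℂ)) (X, w) :=
    (imCLM.comp (ContinuousLinearMap.snd ℝ ℝ ℂ)).hasFDerivAt
  have cX : ContDiffAt ℝ ∞ (fun q : ℝ × ℂ => q.1) (X, w) := contDiffAt_fst
  have cξ : ContDiffAt ℝ ∞ (fun q : ℝ × ℂ => q.2.re) (X, w) :=
    reCLM.contDiff.contDiffAt.comp _ contDiffAt_snd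
  have cη : ContDiffAt ℝ ∞ (fun q : ℝ × ℂ => q.2.im) (X, w) :=
    imCLM.contDiff.contDiffAt.comp _ contDiffAt_snd
  have dY : HasFDerivAt (fun q : ℝ × ℂ => normSq q.2) _ (X, w) := (hξ.mul hξ).add (hη.mul hη)
  have cY : ContDiffAt ℝ ∞ (fun q : ℝ × ℂ => normSq q.2) (X, w) := (cξ.mul cξ).add (cη.mul cη)
  have dθ : HasFDerivAt (fun q : ℝ × ℂ => θ q.2) _ (X, w) := hθ.comp (X, w) hasFDerivAt_snd
  have cθ : ContDiffAt ℝ ∞ (fun q : ℝ × ℂ => θ q.2) (X, w) :=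
    ContDiffAt.comp (X, w) hθc contDiffAt_snd
  have dp := (hasDerivAt_of_infty hp X).comp_hasFDerivAt (X, w) hX
  have dp' := (hasDerivAt_of_infty hp' X).comp_hasFDerivAt (X, w) hX
  have ds := (hasDerivAt_of_infty hs X).comp_hasFDerivAt (X, w) hX
  have ds' := (hasDerivAt_of_infty hs' X).comp_hasFDerivAt (X, w) hX
  have dr := (hasDerivAt_of_infty hr (normSq w)).comp_hasFDerivAt (X, w) dY
  have dr' := (hasDerivAt_of_infty hr' (normSq w)).comp_hasFDerivAt (X, w) dY
  have cp := hp.contDiffAt.comp (X, w) cX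
  have cp' := hp'.contDiffAt.comp (X, w) cX
  have cs := hs.contDiffAt.comp (X, w) cX
  have cs' := hs'.contDiffAt.comp (X, w) cX
  have cr := hr.contDiffAt.comp (X, w) cY
  have cr' := hr'.contDiffAt.comp (X, w) cY
  have cgY := (contDiffAt_const (c := (1 : ℝ))).add (cp.mul cr')
  have dgY := ((dp.mul dr').const_add 1)
  have di := (hasDerivAt_inv hgY).comp_hasFDerivAt (X, w) dgY
  have ci := cgY.inv hgY
  have dg := (dY.add (dp.mul dr)).add ds
  have cg := (cY.add (cp.mul cr)).add cs
  have dlog := (Real.hasDerivAt_log hg.ne').comp_hasFDerivAt (X, w) dg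
  have clog := (Real.contDiffAt_log (n := ∞).2 hg.ne').comp (X, w) cg
  have dlogY := (Real.hasDerivAt_log hY0).comp_hasFDerivAt (X, w) dY
  have clogY := (Real.contDiffAt_log (n := ∞).2 hY0).comp (X, w) cY
  have dγ := ((dθ.mul ((dp'.mul dr).add ds')).mul di).neg
  have cγ := ((cθ.mul ((cp'.mul cr).add cs')).mul ci).neg
  refine isSympAt_phaseMap_exp hY cγ
    ((contDiffAt_const (c := (1 / 2 : ℝ))).mul (clog.sub clogY)) ((cθ.mul ci).sub cθ) dγ
    ((dlog.sub dlogY).const_mul (1 / 2)) ((dθ.mul di).sub dθ) fun u v => ?_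
  have hE : Real.exp (2 * (1 / 2 * (Real.log (normSq w + p X * r (normSq w) + s X) -
      Real.log (normSq w)))) = (normSq w + p X * r (normSq w) + s X) / normSq w := by
    rw [← mul_assoc, show (2 : ℝ) * (1 / 2) = 1 by norm_num, one_mul, Real.exp_sub,
      Real.exp_log hg, Real.exp_log (lt_of_le_of_ne (normSq_nonneg w) hY0.symm)]
  simp only [Function.comp_def, Pi.add_apply, Pi.mul_apply] at hE ⊢
  rw [hE]
  simp [areaForm]
  have hY2 : normSq w = w.re * w.re + w.im * w.im := normSq_apply w
  clear hE dγ cγ dlog clog dlogY clogY dg cg ci di cgY dgY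
  have hg0 := hg.ne'
  clear hg
  generalize θ w = Θ
  generalize deriv (deriv p) X = p2
  generalize deriv (deriv s) X = s2
  generalize deriv (deriv r) (normSq w) = r2
  generalize deriv p X = p1
  generalize deriv s X = s1
  generalize deriv r (normSq w) = r1 at *
  generalize p X = p0 at *
  generalize s X = s0 at *
  generalize r (normSq w) = r0 at *
  generalize normSq w = Y at *
  generalize w.re = m at *
  generalize w.im = n at *
  generalize u.2.re = ur
  generalize u.2.im = ui
  generalize v.2.re = vr
  generalize v.2.im = vi
  generalize u.1 = u1
  generalize v.1 = v1
  generalize hgd : Y + p0 * r0 + s0 = g at *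
  generalize hD : 1 + p0 * r1 = D at *
  field_simp
  subst hD hY2
  ring

/-! ### Branches of the argument and polar maps -/

/-- `k + Im log (c w)` is a local branch of the argument of `w`, up to an additive constant. -/
theorem contDiffAt_im_log_mul {c w : ℂ} (k : ℝ) (h : c * w ∈ slitPlane) :
    ContDiffAt ℝ ∞ (fun w => k + (log (c * w)).im) w := by
  have h1 : ContDiffAt ℝ ∞ (fun w => log (c * w)) w :=
    ((contDiffAt_log h).comp w (contDiffAt_const.mul contDiffAt_id)).restrict_scalars ℝ
  exact contDiffAt_const.add (imCLM.contDiff.contDiffAt.comp w h1)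

theorem hasFDerivAt_im_log_mul {c w : ℂ} (k : ℝ) (h : c * w ∈ slitPlane) :
    HasFDerivAt (fun w => k + (log (c * w)).im)
      ((normSq w)⁻¹ • (w.re • imCLM - w.im • reCLM)) w := by
  have hc : c ≠ 0 := by rintro rfl; simp at h
  have hw : w ≠ 0 := by rintro rfl; simp at h
  have h1 : HasDerivAt (fun w => log (c * w)) (w⁻¹) w := by
    have := ((hasDerivAt_id w).const_mul c).clog h
    refine this.congr_deriv ?_
    simp; field_simp
  have h2 : HasFDerivAt (fun w => log (c * w)) _ w := h1.hasFDerivAt.restrictScalars ℝ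
  have h3 : HasFDerivAt (fun w => k + (log (c * w)).im) _ w :=
    (imCLM.hasFDerivAt.comp w h2).const_add k
  refine h3.congr_fderiv ?_
  ext v
  simp [inv_re, inv_im]
  ring

theorem polarMapOf_snd_eq_of_eq_zero (θ : ℂ → ℝ) {p r s : ℝ → ℝ} {x : ℂ × ℂ}
    (hp : p (normSq x.1) = 0) (hs : s (normSq x.1) = 0) : (polarMapOf θ p r s x).2 = x.2 := by
  simp [polarMapOf, phaseMap, hp, hs]

/-- The formula for `polarMapOf` gives the identity where the cut-offs vanish, even at `w = 0` and on
the cut of the branch `θ`. -/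
theorem polarMapOf_eq_of_eventually_zero (θ : ℂ → ℝ) {p r s : ℝ → ℝ} {x : ℂ × ℂ}
    (hp : p =ᶠ[𝓝 (normSq x.1)] 0) (hs : s =ᶠ[𝓝 (normSq x.1)] 0) : polarMapOf θ p r s x = x := by
  have hp' : deriv p (normSq x.1) = 0 := by rw [hp.deriv_eq]; simp
  have hs' : deriv s (normSq x.1) = 0 := by rw [hs.deriv_eq]; simp
  refine Prod.ext ?_ (polarMapOf_snd_eq_of_eq_zero θ hp.eq_of_nhds hs.eq_of_nhds)
  simp [polarMapOf, phaseMap, hp', hs']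

theorem polarMapOf_eq_of_eventually_zero' (θ : ℂ → ℝ) {p r : ℝ → ℝ} {x : ℂ × ℂ}
    (hr : r =ᶠ[𝓝 (normSq x.2)] 0) : polarMapOf θ p r 0 x = x := by
  have hr' : deriv r (normSq x.2) = 0 := by rw [hr.deriv_eq]; simp
  have hr0 : r (normSq x.2) = 0 := hr.eq_of_nhds
  refine Prod.ext ?_ ?_ <;> simp [polarMapOf, phaseMap, hr', hr0]

theorem continuous_normSq_fst : Continuous fun x : ℂ × ℂ => normSq x.1 :=
  continuous_normSq.comp continuous_fst

theorem continuous_normSq_snd : Continuous fun x : ℂ × ℂ => normSq x.2 :=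
  continuous_normSq.comp continuous_snd

/-- `polarMapOf` with the branch `θ(w) = arg (-w)`, smooth off the half-line `[0, ∞)`. -/
noncomputable def polarMap (p r s : ℝ → ℝ) : ℂ × ℂ → ℂ × ℂ := polarMapOf (fun w => arg (-w)) p r s

theorem isSympAt_polarMap {p r s : ℝ → ℝ} (hp : ContDiff ℝ ∞ p)
    (hr : ContDiff ℝ ∞ r) (hs : ContDiff ℝ ∞ s) {x : ℂ × ℂ} (hx : -x.2 ∈ slitPlane)
    (hg : 0 < normSq x.2 + p (normSq x.1) * r (normSq x.2) + s (normSq x.1))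
    (hgY : 1 + p (normSq x.1) * deriv r (normSq x.2) ≠ 0) :
    IsSympAt (polarMap p r s) x := by
  have e : (fun w : ℂ => arg (-w)) = fun w => 0 + (log (-1 * w)).im := by
    ext w; simp [log_im]
  have hx' : -1 * x.2 ∈ slitPlane := by simpa using hx
  refine isSympAt_polarMapOf hp hr hs x ?_ ?_ ?_ hg hgY
  · rw [e]; exact contDiffAt_im_log_mul 0 hx'
  · rw [e]; exact hasFDerivAt_im_log_mul 0 hx'
  · intro h; simp [h] at hx

theorem isSympAt_polarMap_of_eventually_zero {p r s : ℝ → ℝ} {x : ℂ × ℂ}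
    (hp : p =ᶠ[𝓝 (normSq x.1)] 0) (hs : s =ᶠ[𝓝 (normSq x.1)] 0) : IsSympAt (polarMap p r s) x := by
  refine (isSympAt_id x).congr ?_
  filter_upwards [continuous_normSq_fst.continuousAt.eventually (hp.eventuallyEq_nhds),
    continuous_normSq_fst.continuousAt.eventually (hs.eventuallyEq_nhds)] with y h1 h2
  exact polarMapOf_eq_of_eventually_zero _ h1 h2

theorem isSympAt_polarMap_of_eventually_zero' {p r : ℝ → ℝ} {x : ℂ × ℂ}
    (hr : r =ᶠ[𝓝 (normSq x.2)] 0) : IsSympAt (polarMap p r 0) x := by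
  refine (isSympAt_id x).congr ?_
  filter_upwards [continuous_normSq_snd.continuousAt.eventually (hr.eventuallyEq_nhds)] with y h1
  exact polarMapOf_eq_of_eventually_zero' _ h1

/-- `polarMap` in polar coordinates for `-w`: the modulus squared becomes `g` and the angle is
divided by `∂g/∂Y`. -/
theorem polarMap_snd (p r s : ℝ → ℝ) {x : ℂ × ℂ} (hx : x.2 ≠ 0)
    (hg : 0 < normSq x.2 + p (normSq x.1) * r (normSq x.2) + s (normSq x.1)) :
    -(polarMap p r s x).2 =
      (√(normSq x.2 + p (normSq x.1) * r (normSq x.2) + s (normSq x.1)) : ℝ) *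
        cexp (((arg (-x.2) * (1 + p (normSq x.1) * deriv r (normSq x.2))⁻¹ : ℝ) : ℂ) * I) := by
  have hY : 0 < normSq x.2 := by simpa using hx
  simp only [polarMap, polarMapOf, phaseMap]
  set g := normSq x.2 + p (normSq x.1) * r (normSq x.2) + s (normSq x.1)
  set D := (1 + p (normSq x.1) * deriv r (normSq x.2))⁻¹
  have h1 : Real.exp (1 / 2 * (Real.log g - Real.log (normSq x.2))) = √g / ‖x.2‖ := by
    rw [mul_sub, Real.exp_sub]
    congr 1
    · rw [one_div_mul_eq_div, ← Real.log_sqrt hg.le, Real.exp_log (Real.sqrt_pos.2 hg)]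
    · rw [normSq_eq_norm_sq, Real.log_pow]
      norm_num
      rw [← mul_assoc]
      norm_num
      exact Real.exp_log (norm_pos_iff.2 hx)
  have h2 : -x.2 = (‖x.2‖ : ℝ) * cexp ((arg (-x.2) : ℝ) * I) := by
    rw [← norm_neg x.2, norm_mul_exp_arg_mul_I]
  have h3 : ((arg (-x.2) * D - arg (-x.2) : ℝ) : ℂ) * I =
    ((arg (-x.2) * D : ℝ) : ℂ) * I - ((arg (-x.2) : ℝ) : ℂ) * I := by push_cast; ring
  rw [exp_add, ← ofReal_exp, h1, h3, exp_sub, ← neg_mul]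
  nth_rw 1 [h2]
  have h4 : ((‖x.2‖ : ℝ) : ℂ) ≠ 0 := by simpa using hx
  have h5 := Complex.exp_ne_zero ((arg (-x.2) : ℝ) * I)
  push_cast
  field_simp

theorem normSq_polarMap_snd (p r s : ℝ → ℝ) {x : ℂ × ℂ} (hx : x.2 ≠ 0)
    (hg : 0 < normSq x.2 + p (normSq x.1) * r (normSq x.2) + s (normSq x.1)) :
    normSq (polarMap p r s x).2 =
      normSq x.2 + p (normSq x.1) * r (normSq x.2) + s (normSq x.1) := by
  rw [← normSq_neg, polarMap_snd p r s hx hg, normSq_eq_norm_sq, norm_mul,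
    Complex.norm_exp_ofReal_mul_I, mul_one, Complex.norm_real, Real.norm_eq_abs, sq_abs,
    Real.sq_sqrt hg.le]

theorem arg_neg_polarMap_snd (p r s : ℝ → ℝ) {x : ℂ × ℂ} (hx : x.2 ≠ 0)
    (hg : 0 < normSq x.2 + p (normSq x.1) * r (normSq x.2) + s (normSq x.1))
    (hθ : arg (-x.2) * (1 + p (normSq x.1) * deriv r (normSq x.2))⁻¹ ∈ Set.Ioc (-Real.pi) Real.pi) :
    arg (-(polarMap p r s x).2) =
      arg (-x.2) * (1 + p (normSq x.1) * deriv r (normSq x.2))⁻¹ := by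
  rw [polarMap_snd p r s hx hg, arg_real_mul _ (Real.sqrt_pos.2 hg), exp_mul_I,
    arg_cos_add_sin_mul_I hθ]

theorem normSq_polarMap_fst (p r s : ℝ → ℝ) (x : ℂ × ℂ) :
    normSq (polarMap p r s x).1 = normSq x.1 := normSq_phaseMap_fst _ _ _

/-- The map on the slice `|z|² = X` is either the identity or determined by its polar coordinates,
provided the new angle stays in `(-π, π]`. -/
theorem injOn_polarMap {p r s : ℝ → ℝ} {S : Set (ℂ × ℂ)}
    (h : ∀ x ∈ S, (p (normSq x.1) = 0 ∧ s (normSq x.1) = 0) ∨ (x.2 ≠ 0 ∧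
      0 < normSq x.2 + p (normSq x.1) * r (normSq x.2) + s (normSq x.1) ∧
      0 < 1 + p (normSq x.1) * deriv r (normSq x.2) ∧
      arg (-x.2) * (1 + p (normSq x.1) * deriv r (normSq x.2))⁻¹ ∈ Set.Ioc (-Real.pi) Real.pi))
    (hinj : ∀ X Y Y', Y + p X * r Y + s X = Y' + p X * r Y' + s X → Y = Y') :
    Set.InjOn (polarMap p r s) S := by
  unfold polarMap polarMapOf
  refine injOn_phaseMap fun x hx y hy hxy he => ?_
  have he2 : (polarMap p r s x).2 = (polarMap p r s y).2 := by
    simp only [polarMap, polarMapOf, phaseMap, ← hxy]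
    exact he
  by_cases h0 : p (normSq x.1) = 0 ∧ s (normSq x.1) = 0
  · have h1 := polarMapOf_snd_eq_of_eq_zero (fun w => arg (-w)) (r := r) h0.1 h0.2
    rw [hxy] at h0
    have h2 := polarMapOf_snd_eq_of_eq_zero (fun w => arg (-w)) (r := r) h0.1 h0.2
    exact h1.symm.trans (he2.trans h2)
  · obtain ⟨hx0, hgx, hDx, hθx⟩ := (h x hx).resolve_left h0
    obtain ⟨hy0, hgy, hDy, hθy⟩ := (h y hy).resolve_left (by rwa [← hxy])
    have hn : normSq x.2 = normSq y.2 := by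
      have h1 := normSq_polarMap_snd p r s hx0 hgx
      rw [he2, normSq_polarMap_snd p r s hy0 hgy, ← hxy] at h1
      exact (hinj _ _ _ h1).symm
    have ha : arg (-x.2) = arg (-y.2) := by
      have h1 := arg_neg_polarMap_snd p r s hx0 hgx hθx
      rw [he2, arg_neg_polarMap_snd p r s hy0 hgy hθy, ← hxy, ← hn] at h1
      exact (mul_right_cancel₀ (inv_ne_zero hDx.ne') h1).symm
    have hnn : ‖-x.2‖ = ‖-y.2‖ := by
      rw [norm_neg, norm_neg, Complex.norm_def, Complex.norm_def, hn]
    exact neg_injective (Complex.ext_norm_arg hnn ha)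

/-! ### Discs into circular sectors -/

theorem contDiff_integral {n : ℝ → ℝ} (hn : ContDiff ℝ ∞ n) :
    ContDiff ℝ ∞ (fun x => ∫ y in (0 : ℝ)..x, n y) ∧
      ∀ x, HasDerivAt (fun x => ∫ y in (0 : ℝ)..x, n y) (n x) x := by
  have hd : ∀ x, HasDerivAt (fun x => ∫ y in (0 : ℝ)..x, n y) (n x) x := fun x =>
    (hn.continuous.integral_hasStrictDerivAt 0 x).hasDerivAt
  refine ⟨contDiff_infty_iff_deriv.2 ⟨fun x => (hd x).differentiableAt, ?_⟩, hd⟩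
  rw [funext fun x => (hd x).deriv]
  exact hn

/-- Transport of the length element `n₀ dη` to `n dy` by a diffeomorphism of the line fixing the
origin. -/
theorem exists_transport {n₀ n : ℝ → ℝ} (hn₀ : ContDiff ℝ ∞ n₀) (hn : ContDiff ℝ ∞ n)
    (h₀ : ∀ x, 0 < n₀ x) {e : ℝ} (he : 0 < e) (h₁ : ∀ x, e < n x)
    (ev₀ : ∀ x, n₀ (-x) = n₀ x) (ev : ∀ x, n (-x) = n x) :
    ∃ G : ℝ → ℝ, ContDiff ℝ ∞ G ∧ G 0 = 0 ∧ (∀ x, HasDerivAt G (n₀ x / n (G x)) x) ∧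
      ∀ S T : ℝ, ∫ x in (0 : ℝ)..S, n₀ x ≤ ∫ x in (0 : ℝ)..T, n x → ∀ x, |x| < S → |G x| < T := by
  obtain ⟨cF₀, dF₀⟩ := contDiff_integral hn₀
  obtain ⟨cF, dF⟩ := contDiff_integral hn
  set F₀ := fun x => ∫ y in (0 : ℝ)..x, n₀ y with hF₀
  set F := fun x => ∫ y in (0 : ℝ)..x, n y with hF
  have mF₀ : StrictMono F₀ := strictMono_of_deriv_pos fun x => by rw [(dF₀ x).deriv]; exact h₀ x
  have mF : StrictMono F := strictMono_of_deriv_pos fun x => by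
    rw [(dF x).deriv]; exact he.trans (h₁ x)
  have oF₀ : ∀ x, F₀ (-x) = -F₀ x := fun x => by
    have := intervalIntegral.integral_comp_neg (f := n₀) (a := 0) (b := x)
    simp only [ev₀, neg_zero] at this
    simp only [hF₀]
    rw [this, intervalIntegral.integral_symm]
  have oF : ∀ x, F (-x) = -F x := fun x => by
    have := intervalIntegral.integral_comp_neg (f := n) (a := 0) (b := x)
    simp only [ev, neg_zero] at this
    simp only [hF]
    rw [this, intervalIntegral.integral_symm]
  have hlow : ∀ x, 0 ≤ x → e * x ≤ F x := fun x hx => by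
    have h := intervalIntegral.integral_mono_on (μ := MeasureTheory.volume) (f := fun _ => e)
      (g := n) hx (by simp) (hn.continuous.intervalIntegrable _ _) (fun y _ => (h₁ y).le)
    simp at h
    linarith
  have sF : Function.Surjective F := by
    refine cF.continuous.surjective ?_ ?_
    · refine Filter.tendsto_atTop_mono' _ (f₁ := fun x => e * x) ?_
        (Filter.tendsto_id.const_mul_atTop he)
      filter_upwards [Filter.eventually_ge_atTop 0] with x hx using hlow x hx
    · refine Filter.tendsto_atBot_mono' _ (?_ : F ≤ᶠ[Filter.atBot] fun x => e * x)
        (Filter.tendsto_id.const_mul_atBot he)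
      filter_upwards [Filter.eventually_le_atBot 0] with x hx
      have := hlow (-x) (by linarith)
      rw [oF] at this
      linarith
  set H : ℝ ≃ₜ ℝ := (mF.orderIsoOfSurjective F sF).toHomeomorph
  have hHF' : (H : ℝ → ℝ) = F := rfl
  have cH : ContDiff ℝ ∞ H.symm := H.contDiff_symm_deriv (f' := n)
    (fun x => (he.trans (h₁ x)).ne') (fun x => by rw [hHF']; exact dF x) (by rw [hHF']; exact cF)
  have hFG : ∀ x, F (H.symm (F₀ x)) = F₀ x := fun x => H.apply_symm_apply _
  have hF00 : F₀ 0 = 0 := by simp [hF₀]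
  have hF0 : F 0 = 0 := by simp [hF]
  refine ⟨fun x => H.symm (F₀ x), cH.comp cF₀, ?_, fun x => ?_, fun S T hST x hx => ?_⟩
  · apply mF.injective
    rw [hFG, hF00, hF0]
  · have h1 : HasDerivAt H.symm (n (H.symm (F₀ x)))⁻¹ (F₀ x) := by
      refine HasDerivAt.of_local_left_inverse (f := F) H.symm.continuous.continuousAt (dF _)
        (he.trans (h₁ _)).ne' (Filter.Eventually.of_forall fun y => H.apply_symm_apply y)
    have := h1.comp x (dF₀ x)
    rwa [inv_mul_eq_div] at this
  · change F₀ S ≤ F T at hST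
    obtain ⟨h1, h2⟩ := abs_lt.1 hx
    rw [abs_lt]
    constructor
    · apply mF.lt_iff_lt.1
      rw [hFG, oF]
      have := mF₀ h1
      rw [oF₀] at this
      linarith
    · apply mF.lt_iff_lt.1
      rw [hFG]
      linarith [mF₀ h2]

theorem exists_even_approx {f : ℝ → ℝ} (hf : Continuous f) (ev : ∀ x, f (-x) = f x) {e : ℝ}
    (he : 0 < e) : ∃ g : ℝ → ℝ, ContDiff ℝ ∞ g ∧ (∀ x, g (-x) = g x) ∧ ∀ x, |g x - f x| < e := by
  obtain ⟨g, hg, hd, -⟩ := hf.exists_contDiff_approx (ε := fun _ => e) ⊤ continuous_const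
    fun _ => he
  refine ⟨fun x => (g x + g (-x)) / 2, (hg.add (hg.comp contDiff_neg)).div_const 2, fun x => ?_,
    fun x => ?_⟩
  · simp [add_comm]
  · have h1 := hd x
    have h2 := hd (-x)
    rw [Real.dist_eq, abs_lt] at h1 h2
    rw [ev] at h2
    rw [abs_lt]
    constructor <;> linarith

theorem hasDerivAt_circle_primitive {x : ℝ} (h1 : -1 < x) (h2 : x < 1) :
    HasDerivAt (fun x => (x * √(1 - x ^ 2) + Real.arcsin x) / 2) (√(1 - x ^ 2)) x := by
  have h3 : 0 < 1 - x ^ 2 := by nlinarith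
  have h := (((hasDerivAt_id x).mul (((hasDerivAt_id x).pow 2).const_sub 1 |>.sqrt h3.ne')).add
    (Real.hasDerivAt_arcsin h1.ne' h2.ne)).div_const 2
  refine h.congr_deriv ?_
  have h4 := Real.sq_sqrt h3.le
  have h5 := Real.sqrt_pos.2 h3
  simp
  field_simp
  rw [h4]
  ring

theorem integral_sqrt_circle {a b : ℝ} (ha : -1 ≤ a) (hab : a ≤ b) (hb : b ≤ 1) :
    ∫ x in a..b, √(1 - x ^ 2) = (b * √(1 - b ^ 2) + Real.arcsin b) / 2 -
      (a * √(1 - a ^ 2) + Real.arcsin a) / 2 := by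
  refine intervalIntegral.integral_eq_sub_of_hasDerivAt_of_le
    (f := fun x => (x * √(1 - x ^ 2) + Real.arcsin x) / 2) hab ?_ ?_ ?_
  · have := Real.continuous_arcsin
    fun_prop
  · intro x hx
    exact hasDerivAt_circle_primitive (by linarith [hx.1]) (by linarith [hx.2])
  · exact Continuous.intervalIntegrable (by fun_prop) _ _

theorem integral_sqrt_quarter {A : ℝ} (hA : 0 < A) :
    ∫ x in (0 : ℝ)..√A, √(A - x ^ 2) = Real.pi * A / 4 := by
  have hs := Real.sqrt_pos.2 hA
  have h1 : ∀ x, √(A - x ^ 2) = √A * √(1 - ((√A)⁻¹ * x) ^ 2) := fun x => by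
    rw [← Real.sqrt_mul hA.le]
    congr 1
    have := Real.sq_sqrt hA.le
    field_simp
    rw [this]
    ring
  simp only [h1]
  rw [intervalIntegral.integral_const_mul, intervalIntegral.integral_comp_mul_left
    (f := fun y => √(1 - y ^ 2)) (inv_ne_zero hs.ne'), inv_mul_cancel₀ hs.ne',
    mul_zero, integral_sqrt_circle (by norm_num) zero_le_one le_rfl]
  simp
  rw [← mul_assoc, Real.mul_self_sqrt hA.le]
  ring

/-- The area of the circular sector `{0 ≤ x < y / √3, x² + y² < 1}`. -/
theorem integral_min_sector :
    ∫ y in (0 : ℝ)..1, min (|y| / √3) √(1 - y ^ 2) = Real.pi / 12 := by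
  have h3 : (√3) ^ 2 = 3 := Real.sq_sqrt (by norm_num)
  have h3' : 0 < √3 := Real.sqrt_pos.2 (by norm_num)
  have hlt : √3 / 2 ≤ 1 := by nlinarith
  have hi : ∀ a b : ℝ, IntervalIntegrable (fun y : ℝ => min (|y| / √3) √(1 - y ^ 2))
      MeasureTheory.volume a b := fun a b => Continuous.intervalIntegrable (by fun_prop) _ _
  rw [← intervalIntegral.integral_add_adjacent_intervals (hi 0 (√3 / 2)) (hi _ 1)]
  have e1 : ∫ y in (0 : ℝ)..√3 / 2, min (|y| / √3) √(1 - y ^ 2) =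
      ∫ y in (0 : ℝ)..√3 / 2, y / √3 := by
    refine intervalIntegral.integral_congr fun y hy => ?_
    rw [Set.uIcc_of_le (by positivity)] at hy
    rw [abs_of_nonneg hy.1, min_eq_left]
    apply Real.le_sqrt_of_sq_le
    rw [div_pow, h3]
    nlinarith [hy.1, hy.2]
  have e2 : ∫ y in √3 / 2..1, min (|y| / √3) √(1 - y ^ 2) =
      ∫ y in √3 / 2..1, √(1 - y ^ 2) := by
    refine intervalIntegral.integral_congr fun y hy => ?_
    rw [Set.uIcc_of_le hlt] at hy
    have hy0 : 0 ≤ y := le_trans (by positivity) hy.1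
    change min (|y| / √3) √(1 - y ^ 2) = _
    rw [abs_of_nonneg hy0, min_eq_right]
    rw [Real.sqrt_le_left (by positivity), div_pow, h3]
    nlinarith [hy.1, hy.2]
  have e3 : √(1 - (√3 / 2) ^ 2) = 1 / 2 := by
    rw [div_pow, h3, show (1 : ℝ) - 3 / 2 ^ 2 = (1 / 2) ^ 2 by norm_num,
      Real.sqrt_sq (by norm_num)]
  have e4 : Real.arcsin (√3 / 2) = Real.pi / 3 := by
    rw [← Real.sin_pi_div_three, Real.arcsin_sin] <;> linarith [Real.pi_pos]
  rw [e1, e2, integral_sqrt_circle (le_trans (by norm_num) (by positivity : (0:ℝ) ≤ √3 / 2)) hlt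
    le_rfl, e3, e4, intervalIntegral.integral_div, integral_id]
  simp
  field_simp
  ring

/-- A profile carrying the disc of area `πA` into the sector `{ξ < |η| / √3, ξ² + η² < 1}`, of
area `2π/3`: the composition of `(ξ, η) ↦ (ξ / G'(η), G(η))` with a shear. -/
theorem exists_sector_profile_one {A : ℝ} (hA : 0 < A) (hA1 : A < 2 / 3) :
    ∃ G c : ℝ → ℝ, ContDiff ℝ ∞ G ∧ ContDiff ℝ ∞ c ∧ G 0 = 0 ∧ (∀ η, 0 < deriv G η) ∧
      ∀ ξ η, ξ ^ 2 + η ^ 2 < A → c (G η) + ξ / deriv G η < |G η| / √3 ∧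
        (c (G η) + ξ / deriv G η) ^ 2 + G η ^ 2 < 1 := by
  have hπ := Real.pi_gt_three
  have h3' : 0 < √3 := Real.sqrt_pos.2 (by norm_num)
  set gap := Real.pi / 6 - Real.pi * A / 4 with hgap
  have hgap0 : 0 < gap := by rw [hgap]; nlinarith
  obtain ⟨e, he, he1, he2⟩ : ∃ e : ℝ, 0 < e ∧ e ≤ 1 / 100 ∧ 7 * e ≤ gap :=
    ⟨min (1 / 100) (gap / 7), by positivity, min_le_left _ _, by
      linarith [min_le_right (1 / 100) (gap / 7)]⟩
  have hsA : √A < 1 := by rw [Real.sqrt_lt' one_pos]; linarith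
  -- The slice of the sector at height `y` is `(-√(1 - y²), ρ y)` where `1 - y² > 0`; `N` is its
  -- half-length diminished by `3 e`, truncated so as to stay positive.
  set ρ := fun y : ℝ => min (|y| / √3) √(1 - y ^ 2) with hρ
  have cρ : Continuous ρ := by rw [hρ]; fun_prop
  have hρ0 : ∀ y, 0 ≤ ρ y := fun y => le_min (by positivity) (Real.sqrt_nonneg _)
  set N := fun y : ℝ => max ((ρ y + √(1 - y ^ 2)) / 2 - 3 * e) (2 * e) with hN
  have cN : Continuous N := by rw [hN]; fun_prop
  obtain ⟨n₀, cn₀, ev₀, hn₀⟩ := exists_even_approx (f := fun x => √(A - x ^ 2) + e)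
    (by fun_prop) (fun x => by simp) he
  obtain ⟨n, cn, ev, hn⟩ := exists_even_approx (f := N) cN (fun x => by simp [hN, hρ]) he
  -- `c` approximates the midpoint of the slice.
  obtain ⟨c, cc, -, hc⟩ := exists_even_approx (f := fun y => (ρ y - √(1 - y ^ 2)) / 2)
    (by fun_prop) (fun x => by simp [hρ]) he
  have hn₀1 : ∀ x, √(A - x ^ 2) < n₀ x := fun x => by
    have := (abs_lt.1 (hn₀ x)).1; linarith
  have hn₀2 : ∀ x, n₀ x ≤ √(A - x ^ 2) + 2 * e := fun x => by
    have := (abs_lt.1 (hn₀ x)).2; linarith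
  have hn₀0 : ∀ x, 0 < n₀ x := fun x => (Real.sqrt_nonneg _).trans_lt (hn₀1 x)
  have hne : ∀ x, e < n x := fun x => by
    have := (abs_lt.1 (hn x)).1
    have h2 : 2 * e ≤ N x := le_max_right _ _
    linarith
  obtain ⟨G, cG, G0, dG, hG⟩ := exists_transport cn₀ cn hn₀0 he hne ev₀ ev
  have hG' : ∀ x, deriv G x = n₀ x / n (G x) := fun x => (dG x).deriv
  set T := √(1 - 100 * e ^ 2) with hT
  have hT2 : T ^ 2 = 1 - 100 * e ^ 2 := Real.sq_sqrt (by nlinarith)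
  have hT0 : 0 ≤ T := Real.sqrt_nonneg _
  have hT1 : T ≤ 1 := by nlinarith
  have hTe : 1 - T ≤ e := by nlinarith
  -- Up to `|y| = T` the truncation in `N` plays no role, and there is enough area for the disc.
  have hint : ∫ x in (0 : ℝ)..√A, n₀ x ≤ ∫ x in (0 : ℝ)..T, n x := by
    have i1 : ∫ x in (0 : ℝ)..√A, n₀ x ≤ ∫ x in (0 : ℝ)..√A, (√(A - x ^ 2) + 2 * e) :=
      intervalIntegral.integral_mono_on (Real.sqrt_nonneg _)
        (cn₀.continuous.intervalIntegrable _ _)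
        (Continuous.intervalIntegrable (by fun_prop) _ _) fun x _ => hn₀2 x
    rw [intervalIntegral.integral_add (Continuous.intervalIntegrable (by fun_prop) _ _)
      (by simp), integral_sqrt_quarter hA] at i1
    simp at i1
    have i2 : ∫ x in (0 : ℝ)..T, ((ρ x + √(1 - x ^ 2)) / 2 - 4 * e) ≤ ∫ x in (0 : ℝ)..T, n x :=
      intervalIntegral.integral_mono_on hT0 (Continuous.intervalIntegrable (by fun_prop) _ _)
        (cn.continuous.intervalIntegrable _ _) fun x _ => by
          have := (abs_lt.1 (hn x)).1
          have h2 : (ρ x + √(1 - x ^ 2)) / 2 - 3 * e ≤ N x := le_max_left _ _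
          linarith
    have i3 : ∫ x in T..1, ((ρ x + √(1 - x ^ 2)) / 2 - 4 * e) ≤ ∫ x in T..1, (1 : ℝ) :=
      intervalIntegral.integral_mono_on hT1 (Continuous.intervalIntegrable (by fun_prop) _ _)
        (by simp) fun x _ => by
          have h1 : √(1 - x ^ 2) ≤ 1 := Real.sqrt_le_one.2 (by nlinarith)
          have h2 : ρ x ≤ √(1 - x ^ 2) := min_le_right _ _
          linarith
    have i4 : ∫ x in (0 : ℝ)..1, ((ρ x + √(1 - x ^ 2)) / 2 - 4 * e) = Real.pi / 6 - 4 * e := by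
      rw [intervalIntegral.integral_sub (Continuous.intervalIntegrable (by fun_prop) _ _)
        (by simp), intervalIntegral.integral_div, intervalIntegral.integral_add
        (Continuous.intervalIntegrable (by fun_prop) _ _)
        (Continuous.intervalIntegrable (by fun_prop) _ _), integral_min_sector,
        integral_sqrt_circle (by norm_num) zero_le_one le_rfl]
      simp
      ring
    rw [← intervalIntegral.integral_add_adjacent_intervals (b := T)
      (Continuous.intervalIntegrable (by fun_prop) _ _)
      (Continuous.intervalIntegrable (by fun_prop) _ _)] at i4
    simp only [intervalIntegral.integral_const, smul_eq_mul, mul_one] at i3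
    nlinarith
  refine ⟨G, c, cG, cc, G0, fun η => ?_, fun ξ η h => ?_⟩
  · rw [hG']
    exact div_pos (hn₀0 _) (he.trans (hne _))
  have hη : |η| < √A := Real.lt_sqrt_of_sq_lt (by rw [sq_abs]; nlinarith)
  have hGT := hG _ _ hint η hη
  set y := G η
  have hy2 : y ^ 2 < 1 - 100 * e ^ 2 := by
    rw [← hT2, ← sq_abs y]
    exact pow_lt_pow_left₀ hGT (abs_nonneg _) two_ne_zero
  have hs : 10 * e < √(1 - y ^ 2) := Real.lt_sqrt_of_sq_lt (by nlinarith)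
  have hN' : N y = (ρ y + √(1 - y ^ 2)) / 2 - 3 * e := max_eq_left (by linarith [hρ0 y])
  have hny := (abs_lt.1 (hn y)).2
  have hcy := abs_lt.1 (hc y)
  have hn0 := he.trans (hne y)
  have hξ : |ξ / deriv G η| < n y := by
    rw [hG', div_div_eq_mul_div, abs_div, abs_mul, abs_of_pos hn0, abs_of_pos (hn₀0 _),
      div_lt_iff₀ (hn₀0 _), mul_comm]
    refine mul_lt_mul_of_pos_left (lt_of_le_of_lt ?_ (hn₀1 η)) hn0
    exact Real.abs_le_sqrt (by linarith)
  obtain ⟨h1, h2⟩ := abs_lt.1 hξ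
  have hρ1 : ρ y ≤ |y| / √3 := min_le_left _ _
  have hρ2 : ρ y ≤ √(1 - y ^ 2) := min_le_right _ _
  have hsq : √(1 - y ^ 2) ^ 2 = 1 - y ^ 2 := Real.sq_sqrt (by nlinarith)
  refine ⟨by linarith, ?_⟩
  have h5 : (c y + ξ / deriv G η) ^ 2 < √(1 - y ^ 2) ^ 2 := by
    apply sq_lt_sq'
    · linarith
    · linarith
  linarith

/-- `G` and `deriv C` are the data of a planar symplectic map
`(ξ, η) ↦ (ξ / G'(η) + C'(G(η)), G(η))` carrying the disc `{ξ² + η² < A}` into the sector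
`{ξ < |η| / √3, ξ² + η² < B}`, of opening angle `4π/3`. -/
structure SectorProfile (A B : ℝ) (G C : ℝ → ℝ) : Prop where
  contDiff_G : ContDiff ℝ ∞ G
  contDiff_C : ContDiff ℝ ∞ C
  map_zero : G 0 = 0
  deriv_pos : ∀ η, 0 < deriv G η
  lt_abs : ∀ ξ η, ξ ^ 2 + η ^ 2 < A → deriv C (G η) + ξ / deriv G η < |G η| / √3
  sq_lt : ∀ ξ η, ξ ^ 2 + η ^ 2 < A → (deriv C (G η) + ξ / deriv G η) ^ 2 + G η ^ 2 < B

theorem exists_sectorProfile {A B : ℝ} (hA : 0 < A) (hAB : 3 * A < 2 * B) :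
    ∃ G C : ℝ → ℝ, SectorProfile A B G C := by
  have hB : 0 < B := by linarith
  obtain ⟨G, c, cG, cc, G0, dG, h⟩ := exists_sector_profile_one (A := A / B) (by positivity)
    (by rw [div_lt_div_iff₀ hB (by norm_num)]; linarith)
  have hs := Real.sqrt_pos.2 hB
  have hs2 : √B ^ 2 = B := Real.sq_sqrt hB.le
  have hc : ContDiff ℝ ∞ fun y => √B * c (y / √B) :=
    contDiff_const.mul (cc.comp (contDiff_id.div_const _))
  obtain ⟨cC, dC⟩ := contDiff_integral hc
  have hdG : ∀ η, deriv (fun η => √B * G (η / √B)) η = deriv G (η / √B) := fun η => by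
    have h1 := ((hasDerivAt_of_infty cG (η / √B)).comp η
      ((hasDerivAt_id η).div_const √B)).const_mul √B
    rw [show deriv (fun η => √B * G (η / √B)) η = _ from h1.deriv]
    field_simp
  refine ⟨fun η => √B * G (η / √B), _, contDiff_const.mul (cG.comp (contDiff_id.div_const _)), cC,
    by simp [G0], fun η => ?_, fun ξ η hξ => ?_, fun ξ η hξ => ?_⟩
  · rw [hdG]; exact dG _
  all_goals
    have h1 : (ξ / √B) ^ 2 + (η / √B) ^ 2 < A / B := by
      rw [div_pow, div_pow, hs2, ← add_div]
      exact div_lt_div_of_pos_right hξ hB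
    obtain ⟨h2, h3⟩ := h _ _ h1
    have h4 : √B * c (√B * G (η / √B) / √B) + ξ / deriv G (η / √B) =
        √B * (c (G (η / √B)) + ξ / √B / deriv G (η / √B)) := by
      have := (dG (η / √B)).ne'
      rw [mul_div_cancel_left₀ _ hs.ne']
      field_simp
    rw [(dC _).deriv, hdG, h4]
  · rw [abs_mul, abs_of_pos hs, mul_div_assoc]
    exact mul_lt_mul_of_pos_left h2 hs
  · rw [mul_pow, mul_pow, hs2, ← mul_add]
    nlinarith

/-! ### Interpolation to the sector map, and angles -/

/-- The intermediate maps in the deformation of the identity to the planar map of a sector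
profile stay in the disc of area `πB` and out of a neighbourhood of the far positive real axis. -/
theorem SectorProfile.mid {A B : ℝ} {G C : ℝ → ℝ} (h : SectorProfile A B G C) (hA : 0 < A)
    (hAB : A ≤ B) (hBA : B ≤ 4 * A) {t₁ t₂ : ℝ} (h₁ : t₁ ∈ Set.Icc (0 : ℝ) 1)
    (h₂ : t₂ ∈ Set.Icc (0 : ℝ) 1) (h₁₂ : t₂ ≠ 0 → t₁ = 1) {ξ η ξ' η' : ℝ} (hξ : ξ ^ 2 + η ^ 2 < A)
    (hη' : η' = η + t₁ * (G η - η))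
    (hξ' : ξ' = ξ / (1 + t₁ * (deriv G η - 1)) + t₂ * deriv C η') :
    ξ' ^ 2 + η' ^ 2 < B ∧ ξ' ≤ √A + |η'| / √3 ∧ (t₁ = 1 → t₂ = 1 → ξ' < |η'| / √3) := by
  have hG := h.deriv_pos η
  have a1 := h.lt_abs ξ η hξ
  have a2 := h.lt_abs (-ξ) η (by rwa [neg_sq])
  have b1 := h.sq_lt ξ η hξ
  have b2 := h.sq_lt (-ξ) η (by rwa [neg_sq])
  have hsA := Real.sqrt_nonneg A
  have hsA2 := Real.sq_sqrt hA.le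
  have hk : 0 ≤ |G η| / √3 := by positivity
  have hξA : |ξ| ≤ √A := Real.abs_le_sqrt (by nlinarith)
  rw [neg_div] at a2 b2
  set q := ξ / deriv G η with hq
  set c := deriv C (G η)
  -- The reflection `ξ ↦ -ξ` of the disc bounds `q` without the shift `c`.
  have hqs : q ^ 2 + G η ^ 2 < B := by linarith [sq_nonneg c]
  have hqA : |q| ≤ √A + |G η| / √3 := by
    have h4 : ∀ z : ℝ, z ^ 2 + G η ^ 2 < B → -(2 * √A) < z := fun z hz =>
      (abs_lt.1 (abs_lt_of_sq_lt_sq (by nlinarith [sq_nonneg (G η)]) (by positivity))).1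
    have h5 := h4 _ b1
    have h6 := h4 _ b2
    rw [abs_le]
    constructor <;> linarith
  by_cases ht : t₂ = 0
  · subst ht
    obtain ⟨h10, h11⟩ := h₁
    have hD : 0 < 1 + t₁ * (deriv G η - 1) := by
      rcases h10.eq_or_lt with h0 | h0
      · rw [← h0]; simp
      · nlinarith [mul_pos h0 hG]
    -- Convexity of `D ↦ 1 / D`.
    have hb : |ξ'| ≤ (1 - t₁) * |ξ| + t₁ * |q| := by
      rw [hξ', hq, zero_mul, add_zero, abs_div, abs_div, abs_of_pos hD, abs_of_pos hG,
        div_le_iff₀ hD]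
      have h7 : ((1 - t₁) * |ξ| + t₁ * (|ξ| / deriv G η)) * (1 + t₁ * (deriv G η - 1)) - |ξ| =
          |ξ| * (t₁ * (1 - t₁)) * (deriv G η - 1) ^ 2 / deriv G η := by
        field_simp
        ring
      have h8 : 0 ≤ |ξ| * (t₁ * (1 - t₁)) * (deriv G η - 1) ^ 2 / deriv G η := by
        have : 0 ≤ 1 - t₁ := by linarith
        positivity
      linarith
    -- `G` fixes `0` and is increasing, so `η` and `G η` have the same sign.
    have hsgn : |η'| = (1 - t₁) * |η| + t₁ * |G η| := by
      have mG : StrictMono G := strictMono_of_deriv_pos h.deriv_pos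
      have e : η' = (1 - t₁) * η + t₁ * G η := by rw [hη']; ring
      rcases le_total 0 η with h0 | h0
      · have := mG.monotone h0
        rw [h.map_zero] at this
        rw [abs_of_nonneg h0, abs_of_nonneg this, abs_of_nonneg, e]
        rw [e]
        have : 0 ≤ 1 - t₁ := by linarith
        positivity
      · have := mG.monotone h0
        rw [h.map_zero] at this
        rw [abs_of_nonpos h0, abs_of_nonpos this, abs_of_nonpos, e]
        · ring
        · rw [e]
          have : 0 ≤ 1 - t₁ := by linarith
          nlinarith
    refine ⟨?_, ?_, fun _ h0 => by norm_num at h0⟩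
    · have h7 : |ξ'| ^ 2 ≤ ((1 - t₁) * |ξ| + t₁ * |q|) ^ 2 := pow_le_pow_left₀ (abs_nonneg _) hb 2
      have conv : ∀ x y : ℝ, ((1 - t₁) * x + t₁ * y) ^ 2 ≤ (1 - t₁) * x ^ 2 + t₁ * y ^ 2 := by
        intro x y
        nlinarith [mul_nonneg (mul_nonneg h10 (sub_nonneg.2 h11)) (sq_nonneg (x - y))]
      have h8 := conv |ξ| |q|
      have h9 := conv |η| |G η|
      rw [← hsgn] at h9
      simp only [sq_abs] at h7 h8 h9
      have h12 : (1 - t₁) * (ξ ^ 2 + η ^ 2) + t₁ * (q ^ 2 + G η ^ 2) < B := by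
        rcases h10.eq_or_lt with h0 | h0
        · rw [← h0]; linarith
        · have := mul_lt_mul_of_pos_left hqs h0
          have := mul_le_mul_of_nonneg_left (hξ.le.trans hAB) (sub_nonneg.2 h11)
          linarith
      linarith
    · have h8 : ξ' ≤ (1 - t₁) * |ξ| + t₁ * |q| := (le_abs_self _).trans hb
      rw [hsgn, add_div]
      have h9 : 0 ≤ (1 - t₁) * |η| / √3 := by
        have : 0 ≤ 1 - t₁ := by linarith
        positivity
      rw [mul_div_assoc t₁]
      have h12 := mul_le_mul_of_nonneg_left hξA (sub_nonneg.2 h11)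
      have h13 := mul_le_mul_of_nonneg_left hqA h10
      linarith
  · have ht1 := h₁₂ ht
    subst ht1
    have e1 : η' = G η := by rw [hη']; ring
    have e2 : ξ' = (1 - t₂) * q + t₂ * (c + q) := by
      rw [hξ', e1, hq]; simp; ring
    obtain ⟨h20, h21⟩ := h₂
    refine ⟨?_, ?_, fun _ h0 => ?_⟩
    · rw [e1, e2]
      have : ((1 - t₂) * q + t₂ * (c + q)) ^ 2 ≤ (1 - t₂) * q ^ 2 + t₂ * (c + q) ^ 2 := by
        nlinarith [mul_nonneg (mul_nonneg h20 (sub_nonneg.2 h21)) (sq_nonneg c)]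
      rcases h21.eq_or_lt with h0 | h0
      · rw [h0] at this ⊢; linarith
      · have h7 := mul_le_mul_of_nonneg_left b1.le h20
        have h8 := mul_lt_mul_of_pos_left hqs (sub_pos.2 h0)
        linarith
    · rw [e1, e2]
      have h7 := mul_le_mul_of_nonneg_left ((le_abs_self q).trans hqA) (sub_nonneg.2 h21)
      have h8 := mul_le_mul_of_nonneg_left a1.le h20
      have h9 := mul_nonneg h20 hsA
      linarith
    · rw [e1, e2, h0]
      linarith

/-- The sector of `SectorProfile` is `|arg (-w)| < 2π/3`. -/
theorem abs_arg_neg_lt {w : ℂ} (h : w.re < |w.im| / √3) : |arg (-w)| < 2 * Real.pi / 3 := by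
  by_contra! hc
  have h1 : Real.cos (arg (-w)) ≤ -(1 / 2) := by
    rw [← Real.cos_abs, ← Real.cos_pi_div_three, ← Real.cos_pi_sub]
    refine Real.cos_le_cos_of_nonneg_of_le_pi ?_ (abs_arg_le_pi _) ?_
    · linarith [Real.pi_pos]
    · linarith
  have h2 : ‖w‖ * Real.cos (arg (-w)) = -w.re := by
    rw [← norm_neg, norm_mul_cos_arg, neg_re]
  have h3 : ‖w‖ ^ 2 = w.re * w.re + w.im * w.im := by rw [← normSq_eq_norm_sq, normSq_apply]
  have h4 : ‖w‖ ≤ 2 * w.re := by nlinarith [norm_nonneg w]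
  have h5 : 0 ≤ w.re := by linarith [norm_nonneg w]
  have h6 : |w.im| ≤ √3 * w.re := by
    rw [← Real.sqrt_sq h5, ← Real.sqrt_mul (by norm_num)]
    apply Real.abs_le_sqrt
    nlinarith [norm_nonneg w]
  have h7 : 0 < √3 := Real.sqrt_pos.2 (by norm_num)
  rw [lt_div_iff₀ h7] at h
  linarith

/-- A point far from the origin that is almost in the sector keeps away from the positive axis. -/
theorem abs_arg_neg_le {w : ℂ} {A s : ℝ} (hs0 : 0 ≤ s) (hs : s ≤ 1)
    (h : w.re ≤ √A + |w.im| / √3)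
    (hA : √A < ‖w‖ * (Real.cos s - Real.sin s)) : |arg (-w)| ≤ Real.pi - s := by
  by_contra! hc
  have hπ := Real.pi_gt_three
  have h0 : 0 < ‖w‖ := by
    rcases (norm_nonneg w).eq_or_lt with h1 | h1
    · rw [← h1, zero_mul] at hA
      linarith [Real.sqrt_nonneg A]
    · exact h1
  have h1 : Real.cos (arg (-w)) ≤ -Real.cos s := by
    rw [← Real.cos_abs, ← Real.cos_pi_sub]
    exact Real.cos_le_cos_of_nonneg_of_le_pi (by linarith) (abs_arg_le_pi _) hc.le
  have h2 : ‖w‖ * Real.cos (arg (-w)) = -w.re := by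
    rw [← norm_neg, norm_mul_cos_arg, neg_re]
  have h3 : ‖w‖ * Real.sin (arg (-w)) = -w.im := by
    rw [← norm_neg, norm_mul_sin_arg, neg_im]
  have hcs : 0 < Real.cos s := Real.cos_pos_of_mem_Ioo ⟨by linarith, by linarith⟩
  have hss : 0 ≤ Real.sin s := Real.sin_nonneg_of_nonneg_of_le_pi hs0 (by linarith)
  have h4 : |Real.sin (arg (-w))| ≤ Real.sin s := by
    apply abs_le_of_sq_le_sq _ hss
    nlinarith [Real.sin_sq_add_cos_sq (arg (-w)), Real.sin_sq_add_cos_sq s]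
  have h5 : |w.im| = ‖w‖ * |Real.sin (arg (-w))| := by
    rw [← abs_neg, ← h3, abs_mul, abs_of_pos h0]
  have h6 : |w.im| / √3 ≤ |w.im| := by
    apply div_le_self (abs_nonneg _)
    rw [Real.one_le_sqrt]; norm_num
  nlinarith

/-! ### Moving discs into annuli, with parameters -/

/-- Cut-off functions governing the three successive stages of `isoMap`, and the value `b` of
`|w|²` that the last stage gives to the origin. -/
structure IsoStages (t₁ t₂ t₃ b : ℝ → ℝ) : Prop where
  contDiff_one : ContDiff ℝ ∞ t₁
  contDiff_two : ContDiff ℝ ∞ t₂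
  contDiff_three : ContDiff ℝ ∞ t₃
  contDiff_b : ContDiff ℝ ∞ b
  mem_one : ∀ x, t₁ x ∈ Set.Icc (0 : ℝ) 1
  mem_two : ∀ x, t₂ x ∈ Set.Icc (0 : ℝ) 1
  mem_three : ∀ x, t₃ x ∈ Set.Icc (0 : ℝ) 1
  one_of_two : ∀ x, t₂ x ≠ 0 → t₁ x = 1
  one_of_three : ∀ x ∈ tsupport t₃, t₁ x = 1 ∧ t₂ x = 1
  b_pos : ∀ x, 0 < b x

/-- The lift of the planar map of a sector profile, cut off by `t₁` and `t₂`. -/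
noncomputable def sectorMap (t₁ t₂ G C : ℝ → ℝ) : ℂ × ℂ → ℂ × ℂ :=
  shearMap t₂ C ∘ stretchMap t₁ (fun η => G η - η)

/-- For `|z|²` where all the cut-offs are `1`, this map acts on `w` by sending the disc of area
`πA` into a sector, and then opening that sector, `|w|²` becoming `b + m |w|²`, so that the image
avoids both the positive real axis and the disc `|w|² ≤ b`. Where the cut-offs vanish it is the
identity. -/
noncomputable def isoMap (t₁ t₂ t₃ b G C : ℝ → ℝ) (m : ℝ) : ℂ × ℂ → ℂ × ℂ :=
  polarMap (fun x => t₃ x * (m - 1)) id (fun x => t₃ x * b x) ∘ sectorMap t₁ t₂ G C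

section
variable {t₁ t₂ t₃ b G C : ℝ → ℝ} {A B m : ℝ} {p : ℂ × ℂ}

theorem deriv_sub_id (hG : ContDiff ℝ ∞ G) (η : ℝ) :
    deriv (fun η => G η - η) η = deriv G η - 1 :=
  ((hasDerivAt_of_infty hG η).sub (hasDerivAt_id η)).deriv

theorem normSq_sectorMap_fst : normSq (sectorMap t₁ t₂ G C p).1 = normSq p.1 := by
  unfold sectorMap shearMap stretchMap
  rw [Function.comp_apply, normSq_phaseMap_fst, normSq_phaseMap_fst]

theorem normSq_isoMap_fst : normSq (isoMap t₁ t₂ t₃ b G C m p).1 = normSq p.1 := by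
  unfold isoMap
  rw [Function.comp_apply, normSq_polarMap_fst, normSq_sectorMap_fst]

theorem stretchMap_snd_im (t r : ℝ → ℝ) (p : ℂ × ℂ) :
    (stretchMap t r p).2.im = p.2.im + t (normSq p.1) * r p.2.im := by
  simp only [stretchMap, phaseMap, add_im, ofReal_im, mul_im, ofReal_re, I_im, I_re, mul_one,
    mul_zero, add_zero, zero_add]

theorem stretchMap_snd_re (t r : ℝ → ℝ) (p : ℂ × ℂ) :
    (stretchMap t r p).2.re = p.2.re / (1 + t (normSq p.1) * deriv r p.2.im) := by
  simp only [stretchMap, phaseMap, add_re, ofReal_im, mul_re, ofReal_re, I_im, I_re, mul_one,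
    mul_zero, add_zero, sub_self]

theorem shearMap_snd_im (t C : ℝ → ℝ) (p : ℂ × ℂ) : (shearMap t C p).2.im = p.2.im := by
  simp [shearMap, phaseMap]

theorem shearMap_snd_re (t C : ℝ → ℝ) (p : ℂ × ℂ) :
    (shearMap t C p).2.re = p.2.re + t (normSq p.1) * deriv C p.2.im := by
  simp [shearMap, phaseMap]

theorem sectorMap_snd_im :
    (sectorMap t₁ t₂ G C p).2.im = p.2.im + t₁ (normSq p.1) * (G p.2.im - p.2.im) := by
  rw [sectorMap, Function.comp_apply, shearMap_snd_im, stretchMap_snd_im]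

theorem sectorMap_snd_re (hG : ContDiff ℝ ∞ G) :
    (sectorMap t₁ t₂ G C p).2.re = p.2.re / (1 + t₁ (normSq p.1) * (deriv G p.2.im - 1)) +
      t₂ (normSq p.1) * deriv C (sectorMap t₁ t₂ G C p).2.im := by
  rw [sectorMap_snd_im, ← deriv_sub_id hG]
  have h : normSq (stretchMap t₁ (fun η => G η - η) p).1 = normSq p.1 := normSq_phaseMap_fst _ _ _
  rw [sectorMap, Function.comp_apply, shearMap_snd_re, stretchMap_snd_re, stretchMap_snd_im, h]

theorem sectorMap_den_pos (h : SectorProfile A B G C) (h₁ : ∀ x, t₁ x ∈ Set.Icc (0 : ℝ) 1)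
    (x η : ℝ) : 0 < 1 + t₁ x * (deriv G η - 1) := by
  have hG := h.deriv_pos η
  obtain ⟨h1, h2⟩ := h₁ x
  rcases h1.eq_or_lt with h0 | h0
  · rw [← h0]; simp
  · nlinarith [mul_pos h0 hG]

theorem isSympAt_sectorMap (h : SectorProfile A B G C) (ht : IsoStages t₁ t₂ t₃ b) (p : ℂ × ℂ) :
    IsSympAt (sectorMap t₁ t₂ G C) p := by
  refine (isSympAt_shearMap ht.contDiff_two h.contDiff_C _).comp
    (isSympAt_stretchMap ht.contDiff_one (h.contDiff_G.sub contDiff_id) p ?_)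
  have := sectorMap_den_pos h ht.mem_one (normSq p.1) p.2.im
  rw [← deriv_sub_id h.contDiff_G] at this
  exact this.ne'

theorem injective_sectorMap (h : SectorProfile A B G C) (ht : IsoStages t₁ t₂ t₃ b) :
    Function.Injective (sectorMap t₁ t₂ G C) := by
  have h1 : Function.Injective (shearMap t₂ C) := by
    rw [← Set.injOn_univ]
    unfold shearMap
    refine injOn_phaseMap fun p _ q _ _ he => ?_
    have him := congrArg im he
    simp at him
    rw [him] at he
    exact add_right_cancel he
  refine h1.comp ?_
  rw [← Set.injOn_univ]
  unfold stretchMap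
  refine injOn_phaseMap fun p _ q _ _ he => ?_
  have hre := congrArg re he
  have him := congrArg im he
  simp only [deriv_sub_id h.contDiff_G, add_im, ofReal_im, mul_im, ofReal_re, I_im, I_re, mul_one,
    mul_zero, add_zero, zero_add, add_re, mul_re, sub_self] at hre him
  have hm : StrictMono fun η => η + t₁ (normSq p.1) * (G η - η) := by
    refine strictMono_of_deriv_pos fun η => ?_
    have h2 := (hasDerivAt_id η).add (((hasDerivAt_of_infty h.contDiff_G η).sub
      (hasDerivAt_id η)).const_mul (t₁ (normSq p.1)))
    rw [show deriv (fun η => η + t₁ (normSq p.1) * (G η - η)) η = _ from h2.deriv]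
    exact sectorMap_den_pos h ht.mem_one _ _
  have h3 : p.2.im = q.2.im := hm.injective him
  rw [h3] at hre
  have h4 := sectorMap_den_pos h ht.mem_one (normSq p.1) q.2.im
  exact Complex.ext ((div_left_inj' h4.ne').1 hre) h3

theorem sectorMap_mem (h : SectorProfile A B G C) (ht : IsoStages t₁ t₂ t₃ b) (hA : 0 < A)
    (hAB : A ≤ B) (hBA : B ≤ 4 * A) (hp : normSq p.2 < A) :
    normSq (sectorMap t₁ t₂ G C p).2 < B ∧
      (sectorMap t₁ t₂ G C p).2.re ≤ √A + |(sectorMap t₁ t₂ G C p).2.im| / √3 ∧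
      (normSq p.1 ∈ tsupport t₃ →
        (sectorMap t₁ t₂ G C p).2.re < |(sectorMap t₁ t₂ G C p).2.im| / √3) := by
  have h1 := h.mid hA hAB hBA (ht.mem_one (normSq p.1)) (ht.mem_two (normSq p.1))
    (ht.one_of_two _) (ξ := p.2.re) (η := p.2.im)
    (by rw [normSq_apply] at hp; linarith) sectorMap_snd_im (sectorMap_snd_re h.contDiff_G)
  refine ⟨?_, h1.2.1, fun hx => ?_⟩
  · rw [normSq_apply]; linarith [h1.1]
  · obtain ⟨h2, h3⟩ := ht.one_of_three _ hx
    exact h1.2.2 h2 h3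

theorem sectorMap_snd_eq (h1 : t₁ (normSq p.1) = 0) (h2 : t₂ (normSq p.1) = 0)
    (hG : ContDiff ℝ ∞ G) : (sectorMap t₁ t₂ G C p).2 = p.2 := by
  refine Complex.ext ?_ ?_
  · rw [sectorMap_snd_re hG, h1, h2]; simp
  · rw [sectorMap_snd_im, h1]; simp

theorem sectorMap_fst_eq (h1 : deriv t₁ (normSq p.1) = 0) (h2 : deriv t₂ (normSq p.1) = 0) :
    (sectorMap t₁ t₂ G C p).1 = p.1 := by
  unfold sectorMap shearMap
  rw [Function.comp_apply]
  have h : normSq (stretchMap t₁ (fun η => G η - η) p).1 = normSq p.1 := normSq_phaseMap_fst _ _ _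
  simp only [phaseMap, h, h2]
  simp [stretchMap, phaseMap, h1]

theorem isoMap_eq_self (h : SectorProfile A B G C) (h1 : t₁ =ᶠ[𝓝 (normSq p.1)] 0)
    (h2 : t₂ =ᶠ[𝓝 (normSq p.1)] 0) (h3 : t₃ =ᶠ[𝓝 (normSq p.1)] 0) :
    isoMap t₁ t₂ t₃ b G C m p = p := by
  have hs : sectorMap t₁ t₂ G C p = p :=
    Prod.ext (sectorMap_fst_eq (by rw [h1.deriv_eq]; simp) (by rw [h2.deriv_eq]; simp))
      (sectorMap_snd_eq h1.eq_of_nhds h2.eq_of_nhds h.contDiff_G)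
  unfold isoMap
  rw [Function.comp_apply, hs]
  apply polarMapOf_eq_of_eventually_zero
  · filter_upwards [h3] with x hx; simp [hx]
  · filter_upwards [h3] with x hx; simp [hx]

theorem isoMap_den_pos (ht : IsoStages t₁ t₂ t₃ b) (hm1 : m ≤ 1) (x : ℝ) :
    m ≤ 1 + t₃ x * (m - 1) ∧ 1 + t₃ x * (m - 1) ≤ 1 := by
  obtain ⟨h1, h2⟩ := ht.mem_three x
  constructor <;> nlinarith

theorem ne_zero_of_re_lt {w : ℂ} (h : w.re < |w.im| / √3) : w ≠ 0 := by
  rintro rfl; simp at h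

theorem neg_mem_slitPlane_of_re_lt {w : ℂ} (h : w.re < |w.im| / √3) : -w ∈ slitPlane := by
  rw [mem_slitPlane_iff_arg]
  refine ⟨fun h1 => ?_, by simpa using ne_zero_of_re_lt h⟩
  have := abs_arg_neg_lt h
  rw [h1, abs_of_pos Real.pi_pos] at this
  linarith [Real.pi_pos]

theorem isoMap_radius_pos (ht : IsoStages t₁ t₂ t₃ b) (hm : 2 / 3 < m) (hm1 : m ≤ 1) (x : ℝ)
    {y : ℝ} (hy : 0 < y) : 0 < y + t₃ x * (m - 1) * y + t₃ x * b x := by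
  obtain ⟨h1, h2⟩ := isoMap_den_pos ht hm1 x
  have := mul_nonneg (ht.mem_three x).1 (ht.b_pos x).le
  nlinarith

/-- The opened sector is still smaller than the slit plane, because `m > 2/3`. -/
theorem isoMap_angle (ht : IsoStages t₁ t₂ t₃ b) (hm : 2 / 3 < m) (hm1 : m ≤ 1) (x : ℝ)
    {w : ℂ} (h : w.re < |w.im| / √3) :
    |arg (-w) * (1 + t₃ x * (m - 1) * deriv id (normSq w))⁻¹| < 2 * Real.pi / (3 * m) := by
  obtain ⟨h1, h2⟩ := isoMap_den_pos ht hm1 x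
  have h3 := abs_arg_neg_lt h
  have h0 : 0 < m := by linarith
  rw [deriv_id, mul_one, abs_mul, abs_inv, abs_of_pos (h0.trans_le h1), ← div_eq_mul_inv,
    div_lt_iff₀ (h0.trans_le h1)]
  refine h3.trans_le ?_
  rw [div_mul_eq_mul_div, div_le_div_iff₀ (by norm_num) (by positivity)]
  have := Real.pi_pos
  nlinarith [mul_le_mul_of_nonneg_left h1 this.le]

theorem two_pi_div_lt (hm : 2 / 3 < m) : 2 * Real.pi / (3 * m) < Real.pi := by
  rw [div_lt_iff₀ (by linarith)]
  nlinarith [Real.pi_pos]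

theorem isSympAt_isoMap (h : SectorProfile A B G C) (ht : IsoStages t₁ t₂ t₃ b) (hA : 0 < A)
    (hAB : A ≤ B) (hBA : B ≤ 4 * A) (hm : 2 / 3 < m) (hm1 : m ≤ 1) (hp : normSq p.2 < A) :
    IsSympAt (isoMap t₁ t₂ t₃ b G C m) p := by
  refine IsSympAt.comp ?_ (isSympAt_sectorMap h ht p)
  by_cases hx : normSq p.1 ∈ tsupport t₃
  · have h3 := (sectorMap_mem h ht hA hAB hBA hp).2.2 hx
    have hw := ne_zero_of_re_lt h3
    refine isSympAt_polarMap (ht.contDiff_three.mul contDiff_const) contDiff_id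
      (ht.contDiff_three.mul ht.contDiff_b) (neg_mem_slitPlane_of_re_lt h3) ?_ ?_
    · exact isoMap_radius_pos ht hm hm1 _ (normSq_pos.2 hw)
    · rw [deriv_id, mul_one]
      exact (lt_of_lt_of_le (by linarith) (isoMap_den_pos ht hm1 _).1).ne'
  · rw [notMem_tsupport_iff_eventuallyEq] at hx
    refine isSympAt_polarMap_of_eventually_zero ?_ ?_ <;> rw [normSq_sectorMap_fst] <;>
      filter_upwards [hx] with x hx <;> simp [hx]

theorem injOn_isoMap (h : SectorProfile A B G C) (ht : IsoStages t₁ t₂ t₃ b) (hA : 0 < A)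
    (hAB : A ≤ B) (hBA : B ≤ 4 * A) (hm : 2 / 3 < m) (hm1 : m ≤ 1) :
    Set.InjOn (isoMap t₁ t₂ t₃ b G C m) {p | normSq p.2 < A} := by
  refine Set.InjOn.comp (t := sectorMap t₁ t₂ G C '' {p | normSq p.2 < A}) ?_
    (injective_sectorMap h ht).injOn (Set.mapsTo_image _ _)
  refine injOn_polarMap ?_ fun X Y Y' he => ?_
  · rintro _ ⟨p, hp, rfl⟩
    by_cases hx : normSq p.1 ∈ tsupport t₃
    · right
      have h3 := (sectorMap_mem h ht hA hAB hBA hp).2.2 hx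
      have hw := ne_zero_of_re_lt h3
      have h4 := (isoMap_angle ht hm hm1 (normSq (sectorMap t₁ t₂ G C p).1) h3).trans
        (two_pi_div_lt hm)
      refine ⟨hw, isoMap_radius_pos ht hm hm1 _ (normSq_pos.2 hw), ?_, ?_⟩
      · rw [deriv_id, mul_one]
        exact lt_of_lt_of_le (by linarith) (isoMap_den_pos ht hm1 _).1
      · exact ⟨(abs_lt.1 h4).1, (abs_lt.1 h4).2.le⟩
    · left
      rw [normSq_sectorMap_fst, image_eq_zero_of_notMem_tsupport hx]
      simp
  · have h5 := (isoMap_den_pos ht hm1 X).1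
    have h6 : (Y - Y') * (1 + t₃ X * (m - 1)) = 0 := by
      simp only [id] at he
      linarith
    rcases mul_eq_zero.1 h6 with h7 | h7
    · linarith
    · linarith

/-- Size of the second component of `isoMap`. -/
theorem exists_normSq_isoMap_snd (h : SectorProfile A B G C) (ht : IsoStages t₁ t₂ t₃ b)
    (hA : 0 < A) (hAB : A ≤ B) (hBA : B ≤ 4 * A) (hm : 2 / 3 < m) (hm1 : m ≤ 1)
    (hp : normSq p.2 < A) :
    ∃ y, 0 ≤ y ∧ y < B ∧ normSq (isoMap t₁ t₂ t₃ b G C m p).2 =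
      (1 - t₃ (normSq p.1)) * y + t₃ (normSq p.1) * (b (normSq p.1) + m * y) ∧
      (t₃ (normSq p.1) ≠ 0 → 0 < y) := by
  have hs := sectorMap_mem h ht hA hAB hBA hp
  refine ⟨normSq (sectorMap t₁ t₂ G C p).2, normSq_nonneg _, hs.1, ?_, fun h0 => ?_⟩
  · unfold isoMap
    by_cases hx : normSq p.1 ∈ tsupport t₃
    · have hw := ne_zero_of_re_lt (hs.2.2 hx)
      rw [Function.comp_apply, normSq_polarMap_snd _ _ _ hw
        (isoMap_radius_pos ht hm hm1 _ (normSq_pos.2 hw)), normSq_sectorMap_fst]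
      simp only [id]
      ring
    · have h0 := image_eq_zero_of_notMem_tsupport hx
      rw [Function.comp_apply, polarMap, polarMapOf_snd_eq_of_eq_zero, h0]
      · simp
      · rw [normSq_sectorMap_fst, h0]; simp
      · rw [normSq_sectorMap_fst, h0]; simp
  · exact normSq_pos.2 (ne_zero_of_re_lt (hs.2.2 (subset_tsupport _ h0)))

/-- Either the last stage of `isoMap` is active and the angle of the second component is
controlled by the sector, or it is not and the second component is almost in the sector. -/
theorem isoMap_snd_angle (h : SectorProfile A B G C) (ht : IsoStages t₁ t₂ t₃ b)
    (hA : 0 < A) (hAB : A ≤ B) (hBA : B ≤ 4 * A) (hm : 2 / 3 < m) (hm1 : m ≤ 1)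
    (hp : normSq p.2 < A) :
    |arg (-(isoMap t₁ t₂ t₃ b G C m p).2)| < 2 * Real.pi / (3 * m) ∨
      (isoMap t₁ t₂ t₃ b G C m p).2.re ≤ √A + |(isoMap t₁ t₂ t₃ b G C m p).2.im| / √3 := by
  have hs := sectorMap_mem h ht hA hAB hBA hp
  unfold isoMap
  rw [Function.comp_apply]
  by_cases hx : normSq p.1 ∈ tsupport t₃
  · left
    have h3 := hs.2.2 hx
    have hw := ne_zero_of_re_lt h3
    have h4 := isoMap_angle ht hm hm1 (normSq (sectorMap t₁ t₂ G C p).1) h3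
    have h5 := h4.trans (two_pi_div_lt hm)
    rw [arg_neg_polarMap_snd _ _ _ hw (isoMap_radius_pos ht hm hm1 _ (normSq_pos.2 hw))
      ⟨(abs_lt.1 h5).1, (abs_lt.1 h5).2.le⟩]
    exact h4
  · right
    have h0 := image_eq_zero_of_notMem_tsupport hx
    rw [polarMap, polarMapOf_snd_eq_of_eq_zero]
    · exact hs.2.1
    · rw [normSq_sectorMap_fst, h0]; simp
    · rw [normSq_sectorMap_fst, h0]; simp

/-- Where all the stages are complete, `isoMap` turns `z` by an angle at most `π |b'(|z|²)|`. -/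
theorem exists_isoMap_fst (h : SectorProfile A B G C) (ht : IsoStages t₁ t₂ t₃ b)
    (hA : 0 < A) (hAB : A ≤ B) (hBA : B ≤ 4 * A) (hm : 2 / 3 < m) (hm1 : m ≤ 1)
    (hp : normSq p.2 < A) (h1 : t₁ =ᶠ[𝓝 (normSq p.1)] 1) (h2 : t₂ =ᶠ[𝓝 (normSq p.1)] 1)
    (h3 : t₃ =ᶠ[𝓝 (normSq p.1)] 1) :
    ∃ γ : ℝ, |γ| ≤ Real.pi * |deriv b (normSq p.1)| ∧
      (isoMap t₁ t₂ t₃ b G C m p).1 = cexp (γ * I) * p.1 := by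
  have d1 : deriv t₁ (normSq p.1) = 0 := by rw [h1.deriv_eq]; simp
  have d2 : deriv t₂ (normSq p.1) = 0 := by rw [h2.deriv_eq]; simp
  have d3 : deriv (fun x => t₃ x * (m - 1)) (normSq p.1) = 0 := by
    have : (fun x => t₃ x * (m - 1)) =ᶠ[𝓝 (normSq p.1)] fun _ => m - 1 := by
      filter_upwards [h3] with x hx; simp [hx]
    rw [this.deriv_eq]; simp
  have d4 : deriv (fun x => t₃ x * b x) (normSq p.1) = deriv b (normSq p.1) := by
    have : (fun x => t₃ x * b x) =ᶠ[𝓝 (normSq p.1)] b := by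
      filter_upwards [h3] with x hx; simp [hx]
    rw [this.deriv_eq]
  have hx : normSq p.1 ∈ tsupport t₃ := subset_tsupport _ (by
    rw [Function.mem_support, h3.eq_of_nhds]; simp)
  have hs := (sectorMap_mem h ht hA hAB hBA hp).2.2 hx
  have h4 := ((isoMap_angle ht hm hm1 (normSq (sectorMap t₁ t₂ G C p).1) hs).trans
    (two_pi_div_lt hm)).le
  rw [normSq_sectorMap_fst] at h4
  refine ⟨-(arg (-(sectorMap t₁ t₂ G C p).2) *
    (deriv (fun x => t₃ x * (m - 1)) (normSq p.1) * id (normSq (sectorMap t₁ t₂ G C p).2) +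
      deriv (fun x => t₃ x * b x) (normSq p.1)) *
    (1 + t₃ (normSq p.1) * (m - 1) * deriv id (normSq (sectorMap t₁ t₂ G C p).2))⁻¹), ?_, ?_⟩
  rotate_left
  · unfold isoMap polarMap polarMapOf
    rw [Function.comp_apply]
    simp only [phaseMap, sectorMap_fst_eq d1 d2]
  · rw [d3, d4, zero_mul, zero_add, mul_right_comm, abs_neg, abs_mul]
    exact mul_le_mul_of_nonneg_right h4 (abs_nonneg _)

end

/-! ### A symplectic chart adapted to the distance from the origin -/

/-- A smooth right inverse of a symplectic map is symplectic. -/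
theorem IsSympAt.of_comp_eq_id {f g : ℂ × ℂ → ℂ × ℂ} {p : ℂ × ℂ} (hg : IsSympAt g (f p))
    (hf : ContDiffAt ℝ ∞ f p) (h : g ∘ f =ᶠ[𝓝 p] id) : IsSympAt f p := by
  refine ⟨hf, fun u v => ?_⟩
  have h1 : (fderiv ℝ g (f p)).comp (fderiv ℝ f p) = ContinuousLinearMap.id ℝ (ℂ × ℂ) := by
    rw [← fderiv_comp p hg.differentiableAt (hf.differentiableAt (by simp)), h.fderiv_eq,
      fderiv_id]
  have h2 : ∀ u, fderiv ℝ g (f p) (fderiv ℝ f p u) = u := fun u => by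
    rw [← ContinuousLinearMap.comp_apply, h1, ContinuousLinearMap.id_apply]
  rw [← hg.2, h2, h2]

/-- The symplectic chart `(u, ζ)` of `{w ≠ 0}` with `|u|² = |z|²`, `|ζ|² = |z|² + |w|²`, where `ζ`
has the phase of `w` and `u` the relative phase of `z` and `w`. -/
noncomputable def toReduced (p : ℂ × ℂ) : ℂ × ℂ :=
  (p.1 * starRingEnd ℂ p.2 * (‖p.2‖⁻¹ : ℝ), (√(normSq p.1 + normSq p.2) * ‖p.2‖⁻¹ : ℝ) * p.2)

/-- The inverse of the chart `toReduced`, on `{|u| < |ζ|}`. -/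
noncomputable def ofReduced (q : ℂ × ℂ) : ℂ × ℂ :=
  (q.1 * q.2 * (‖q.2‖⁻¹ : ℝ), (√(normSq q.2 - normSq q.1) * ‖q.2‖⁻¹ : ℝ) * q.2)

theorem normSq_toReduced_fst {p : ℂ × ℂ} (hp : p.2 ≠ 0) :
    normSq (toReduced p).1 = normSq p.1 := by
  have : ‖p.2‖ ≠ 0 := by simpa using hp
  simp [toReduced, normSq_eq_norm_sq, mul_pow]
  field_simp

theorem normSq_toReduced_snd {p : ℂ × ℂ} (hp : p.2 ≠ 0) :
    normSq (toReduced p).2 = normSq p.1 + normSq p.2 := by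
  have : ‖p.2‖ ≠ 0 := by simpa using hp
  have h := Real.sq_sqrt (add_nonneg (normSq_nonneg p.1) (normSq_nonneg p.2))
  simp only [toReduced]
  rw [normSq_mul, normSq_ofReal, normSq_eq_norm_sq p.2] at *
  field_simp
  exact h

theorem normSq_ofReduced_fst {p : ℂ × ℂ} (hp : p.2 ≠ 0) :
    normSq (ofReduced p).1 = normSq p.1 := by
  have : ‖p.2‖ ≠ 0 := by simpa using hp
  simp [ofReduced, normSq_eq_norm_sq, mul_pow]
  field_simp

theorem normSq_ofReduced_snd {p : ℂ × ℂ} (hp : normSq p.1 < normSq p.2) :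
    normSq (ofReduced p).2 = normSq p.2 - normSq p.1 := by
  have : ‖p.2‖ ≠ 0 := by
    intro h
    rw [norm_eq_zero] at h
    rw [h, normSq_zero] at hp
    exact absurd (normSq_nonneg p.1) hp.not_ge
  have h := Real.sq_sqrt (sub_nonneg.2 hp.le)
  simp only [ofReduced]
  rw [normSq_mul, normSq_ofReal, normSq_eq_norm_sq p.2] at *
  field_simp
  exact h

theorem arg_neg_toReduced_snd {p : ℂ × ℂ} (hp : p.2 ≠ 0) :
    arg (-(toReduced p).2) = arg (-p.2) := by
  have h1 : 0 < ‖p.2‖ := by simpa using hp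
  have h2 : 0 < normSq p.2 := normSq_pos.2 hp
  have h3 : 0 < √(normSq p.1 + normSq p.2) := Real.sqrt_pos.2 (by linarith [normSq_nonneg p.1])
  simp only [toReduced]
  rw [← mul_neg, arg_real_mul _ (by positivity)]

theorem ofReduced_toReduced {p : ℂ × ℂ} (hp : p.2 ≠ 0) : ofReduced (toReduced p) = p := by
  have h1 : 0 < ‖p.2‖ := by simpa using hp
  have h1' : (‖p.2‖ : ℂ) ≠ 0 := by exact_mod_cast h1.ne'
  have h2 : 0 < normSq p.2 := normSq_pos.2 hp
  have h3 : 0 < √(normSq p.1 + normSq p.2) := Real.sqrt_pos.2 (by linarith [normSq_nonneg p.1])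
  have h3' : (√(normSq p.1 + normSq p.2) : ℂ) ≠ 0 := by exact_mod_cast h3.ne'
  have h4 : ‖(toReduced p).2‖ = √(normSq p.1 + normSq p.2) := by
    rw [← normSq_toReduced_snd hp, ← Complex.norm_def]
  have h5 : starRingEnd ℂ p.2 * p.2 = (‖p.2‖ : ℂ) ^ 2 := by
    rw [mul_comm, mul_conj, normSq_eq_norm_sq]; push_cast; rfl
  unfold ofReduced
  rw [h4, normSq_toReduced_fst hp, normSq_toReduced_snd hp, add_sub_cancel_left,
    ← Complex.norm_def]
  simp only [toReduced]
  refine Prod.ext ?_ ?_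
  · push_cast
    field_simp
    linear_combination p.1 * h5
  · push_cast
    field_simp

theorem ofReduced_snd_ne_zero {q : ℂ × ℂ} (hq : normSq q.1 < normSq q.2) :
    (ofReduced q).2 ≠ 0 := by
  intro h
  have := normSq_ofReduced_snd hq
  rw [h, normSq_zero] at this
  linarith

theorem toReduced_ofReduced {q : ℂ × ℂ} (hq : normSq q.1 < normSq q.2) :
    toReduced (ofReduced q) = q := by
  have h0 : q.2 ≠ 0 := by
    intro h
    rw [h, normSq_zero] at hq
    exact absurd (normSq_nonneg q.1) hq.not_ge
  have h1 : 0 < ‖q.2‖ := by simpa using h0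
  have h1' : (‖q.2‖ : ℂ) ≠ 0 := by exact_mod_cast h1.ne'
  have h3 : 0 < √(normSq q.2 - normSq q.1) := Real.sqrt_pos.2 (by linarith)
  have h3' : (√(normSq q.2 - normSq q.1) : ℂ) ≠ 0 := by exact_mod_cast h3.ne'
  have h4 : ‖(ofReduced q).2‖ = √(normSq q.2 - normSq q.1) := by
    rw [← normSq_ofReduced_snd hq, ← Complex.norm_def]
  have h5 : q.2 * starRingEnd ℂ q.2 = (‖q.2‖ : ℂ) ^ 2 := by
    rw [mul_conj, normSq_eq_norm_sq]; push_cast; rfl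
  unfold toReduced
  rw [h4, normSq_ofReduced_fst h0, normSq_ofReduced_snd hq, add_sub_cancel,
    ← Complex.norm_def]
  simp only [ofReduced]
  refine Prod.ext ?_ ?_
  · simp only [map_mul, conj_ofReal]
    push_cast
    field_simp
    linear_combination q.1 * h5
  · push_cast
    field_simp

/-- Locally the chart is a polar map with `g = |w|² + |z|²`, for any branch of the argument. -/
theorem isSympAt_toReduced {p : ℂ × ℂ} (hp : p.2 ≠ 0) : IsSympAt toReduced p := by
  have h1 : 0 < ‖p.2‖ := by simpa using hp
  have hsl : (p.2)⁻¹ * p.2 ∈ slitPlane := by rw [inv_mul_cancel₀ hp]; exact one_mem_slitPlane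
  have h := isSympAt_polarMapOf (θ := fun w => arg p.2 + (log ((p.2)⁻¹ * w)).im) (p := 0) (r := 0)
    (s := id) contDiff_const contDiff_const contDiff_id p
    (contDiffAt_im_log_mul _ hsl) (hasFDerivAt_im_log_mul _ hsl) hp
    (by
      have := normSq_pos.2 hp
      have := normSq_nonneg p.1
      simp only [Pi.zero_apply, id]
      linarith) (by simp)
  refine h.congr ?_
  filter_upwards [continuous_snd.continuousAt.eventually_ne hp] with q hq
  have hq1 : 0 < ‖q.2‖ := by simpa using hq
  have hθ : cexp (((arg p.2 + (log ((p.2)⁻¹ * q.2)).im : ℝ) : ℂ) * I) = q.2 * (‖q.2‖⁻¹ : ℝ) := by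
    rw [log_im, ofReal_add, add_mul, exp_add]
    have e1 := norm_mul_exp_arg_mul_I p.2
    have e2 := norm_mul_exp_arg_mul_I ((p.2)⁻¹ * q.2)
    have n1 : (‖p.2‖ : ℂ) ≠ 0 := by exact_mod_cast h1.ne'
    have n2 : (‖q.2‖ : ℂ) ≠ 0 := by exact_mod_cast hq1.ne'
    rw [norm_mul, norm_inv] at e2
    push_cast at e2 ⊢
    generalize cexp (arg p.2 * I) = E1 at *
    generalize cexp (arg ((p.2)⁻¹ * q.2) * I) = E2 at *
    have e3 : p.2 * (‖q.2‖ * E2) = ‖p.2‖ * q.2 := by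
      field_simp at e2
      linear_combination e2
    field_simp
    apply mul_left_cancel₀ n1
    linear_combination e3 + ‖q.2‖ * E2 * e1
  have hθ' : cexp ((-(arg p.2 + (log ((p.2)⁻¹ * q.2)).im) : ℝ) * I) =
      starRingEnd ℂ q.2 * (‖q.2‖⁻¹ : ℝ) := by
    have e1 := congrArg (starRingEnd ℂ) hθ
    rw [← exp_conj, map_mul, map_mul, conj_ofReal, conj_I, conj_ofReal] at e1
    rw [← e1]
    congr 1
    push_cast
    ring
  have hY := normSq_pos.2 hq
  have hX := normSq_nonneg q.1
  have hg : Real.exp (1 / 2 * (Real.log (normSq q.2 + normSq q.1) - Real.log (normSq q.2))) =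
      √(normSq q.1 + normSq q.2) * ‖q.2‖⁻¹ := by
    rw [mul_sub, Real.exp_sub, one_div_mul_eq_div, one_div_mul_eq_div,
      ← Real.log_sqrt (by linarith), ← Real.log_sqrt hY.le, Real.exp_log (Real.sqrt_pos.2 hY),
      Real.exp_log (Real.sqrt_pos.2 (by linarith)), ← Complex.norm_def, add_comm, div_eq_mul_inv]
  simp only [toReduced, polarMapOf, phaseMap]
  refine Prod.ext ?_ ?_
  · simp only [Pi.zero_apply, zero_mul, add_zero, inv_one, mul_one, deriv_id]
    rw [show deriv (0 : ℝ → ℝ) (normSq q.1) = 0 by simp, zero_mul, zero_add, mul_one, hθ']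
    ring
  · simp only [Pi.zero_apply, zero_mul, add_zero, inv_one, mul_one, id, sub_self, ofReal_zero]
    rw [← ofReal_exp, hg, mul_comm]

theorem isSympAt_ofReduced {q : ℂ × ℂ} (hq : normSq q.1 < normSq q.2) : IsSympAt ofReduced q := by
  have h0 : q.2 ≠ 0 := by
    intro h
    rw [h, normSq_zero] at hq
    exact absurd (normSq_nonneg q.1) hq.not_ge
  refine (isSympAt_toReduced (ofReduced_snd_ne_zero hq)).of_comp_eq_id ?_ ?_
  · have c2 : ContDiffAt ℝ ∞ (fun q : ℂ × ℂ => ‖q.2‖⁻¹) q :=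
      (contDiffAt_snd.norm ℝ h0).inv (by simpa using h0)
    have c3 : ContDiffAt ℝ ∞ (fun q : ℂ × ℂ => √(normSq q.2 - normSq q.1)) q := by
      simp only [normSq_eq_norm_sq] at hq ⊢
      exact ((contDiffAt_snd.norm_sq ℝ).sub (contDiffAt_fst.norm_sq ℝ)).sqrt (by linarith)
    exact ((contDiffAt_fst.mul contDiffAt_snd).mul
      (ofRealCLM.contDiff.contDiffAt.comp q c2)).prodMk
      ((ofRealCLM.contDiff.contDiffAt.comp q (c3.mul c2)).mul contDiffAt_snd)
  · filter_upwards [continuous_normSq_fst.continuousAt.eventually_lt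
      continuous_normSq_snd.continuousAt hq] with x hx using toReduced_ofReduced hx

/-! ### Levels of `|z|² + |w|²` pushed off two tori -/

/-- A smooth step: `0` on `(-∞, c]` and `1` on `[c + e, ∞)`. -/
noncomputable def stepFun (c e x : ℝ) : ℝ := Real.smoothTransition ((x - c) / e)

section
variable {c e x : ℝ}

theorem contDiff_stepFun (c e : ℝ) : ContDiff ℝ ∞ (stepFun c e) :=
  Real.smoothTransition.contDiff.comp ((contDiff_id.sub contDiff_const).div_const _)

theorem stepFun_mem (c e x : ℝ) : stepFun c e x ∈ Set.Icc (0 : ℝ) 1 :=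
  ⟨Real.smoothTransition.nonneg _, Real.smoothTransition.le_one _⟩

theorem stepFun_zero (he : 0 < e) (h : x ≤ c) : stepFun c e x = 0 :=
  Real.smoothTransition.zero_of_nonpos (div_nonpos_of_nonpos_of_nonneg (by linarith) he.le)

theorem stepFun_one (he : 0 < e) (h : c + e ≤ x) : stepFun c e x = 1 :=
  Real.smoothTransition.one_of_one_le (by rw [le_div_iff₀ he]; linarith)

theorem stepFun_eventually_zero (he : 0 < e) (h : x < c) : stepFun c e =ᶠ[𝓝 x] 0 := by
  filter_upwards [eventually_lt_nhds h] with y hy using stepFun_zero he hy.le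

theorem stepFun_eventually_one (he : 0 < e) (h : c + e < x) : stepFun c e =ᶠ[𝓝 x] 1 := by
  filter_upwards [eventually_gt_nhds h] with y hy using stepFun_one he hy.le

theorem lt_of_stepFun_ne_zero (he : 0 < e) (h : stepFun c e x ≠ 0) : c < x := by
  by_contra! hx; exact h (stepFun_zero he hx)

theorem le_of_mem_tsupport_stepFun (he : 0 < e) (h : x ∈ tsupport (stepFun c e)) : c ≤ x := by
  have h1 : tsupport (stepFun c e) ⊆ Set.Ici c :=
    closure_minimal (fun y hy => (lt_of_stepFun_ne_zero he hy).le) isClosed_Ici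
  exact h1 h

theorem monotone_stepFun (he : 0 < e) : Monotone (stepFun c e) := by
  intro x y hxy
  exact Real.smoothTransition.monotone (div_le_div_of_nonneg_right (by linarith) he.le)

theorem deriv_stepFun_nonneg (he : 0 < e) (x : ℝ) : 0 ≤ deriv (stepFun c e) x :=
  (monotone_stepFun he).deriv_nonneg

end

theorem exists_deriv_smoothTransition_le : ∃ K : ℝ, 0 < K ∧
    ∀ x, |deriv Real.smoothTransition x| ≤ K := by
  have hc : Continuous (deriv Real.smoothTransition) :=
    (contDiff_deriv_of_infty Real.smoothTransition.contDiff).continuous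
  obtain ⟨K, hK⟩ := (isCompact_Icc (a := (0 : ℝ)) (b := 1)).exists_bound_of_continuousOn
    hc.continuousOn
  refine ⟨|K| + 1, by positivity, fun x => ?_⟩
  by_cases hx : x ∈ Set.Icc (0 : ℝ) 1
  · have := hK x hx
    rw [Real.norm_eq_abs] at this
    linarith [le_abs_self K]
  · have : deriv Real.smoothTransition x = 0 := by
      rcases lt_or_ge x 0 with h | h
      · have h1 : Real.smoothTransition =ᶠ[𝓝 x] 0 := by
          filter_upwards [eventually_lt_nhds h] with y hy using
            Real.smoothTransition.zero_of_nonpos hy.le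
        rw [h1.deriv_eq]; simp
      · have h2 : 1 < x := by by_contra! h3; exact hx ⟨h, h3⟩
        have h1 : Real.smoothTransition =ᶠ[𝓝 x] 1 := by
          filter_upwards [eventually_gt_nhds h2] with y hy using
            Real.smoothTransition.one_of_one_le hy.le
        rw [h1.deriv_eq]; simp
    rw [this, abs_zero]
    positivity

/-- The numerical data of `reducedMap`: the last stage of its `isoMap` sends a disc of area
slightly above `π` into the annulus between `b` and `b + (2 - b (3 - e))`, where `b` rises very
slowly from just below `1` at `3 - e` to `1` at `3`. -/
structure ReducedData (e κ m : ℝ) (b G C : ℝ → ℝ) : Prop where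
  e_pos : 0 < e
  e_le : e ≤ 1 / 20
  κ_pos : 0 < κ
  κ_le : κ ≤ 1 / 40
  lt_m : 2 / 3 < m
  m_le : m ≤ 1
  profile : SectorProfile (1 + κ) (3 / 2 * (1 + 2 * κ)) G C
  contDiff_b : ContDiff ℝ ∞ b
  le_b : ∀ x, 9 / 10 ≤ b x
  b_le : ∀ x, b x ≤ 1
  b_three : b 3 = 1
  b_sub : b (3 - e) + m * (3 / 2 * (1 + 2 * κ)) = 2
  deriv_b : ∀ x, Real.pi * |deriv b x| < e

theorem exists_reducedData {e : ℝ} (he : 0 < e) (he1 : e ≤ 1 / 20) :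
    ∃ κ m : ℝ, κ ≤ e ∧ ∃ b G C, ReducedData e κ m b G C := by
  obtain ⟨K, hK, hd⟩ := exists_deriv_smoothTransition_le
  have hπ := Real.pi_pos
  obtain ⟨κ, hκ, hκ1, hκ2, hκ3⟩ : ∃ κ : ℝ, 0 < κ ∧ κ ≤ 1 / 40 ∧ κ ≤ e ∧
      κ ≤ e ^ 2 / (8 * Real.pi * K) := by
    have : 0 < e ^ 2 / (8 * Real.pi * K) := by positivity
    exact ⟨min (1 / 40) (min e (e ^ 2 / (8 * Real.pi * K))), by positivity, min_le_left _ _,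
      (min_le_right _ _).trans (min_le_left _ _), (min_le_right _ _).trans (min_le_right _ _)⟩
  rw [le_div_iff₀ (by positivity)] at hκ3
  -- `b` rises by only `δ ≤ 4 κ` over a length `e`, so `κ` small makes `b'` as small as desired.
  obtain ⟨G, C, h⟩ := exists_sectorProfile (A := 1 + κ) (B := 3 / 2 * (1 + 2 * κ))
    (by linarith) (by linarith)
  set δ := (1 + κ) * (1 + 2 * κ) - 1 with hδ
  have hδ0 : 0 < δ := by nlinarith
  have hδ1 : δ ≤ 4 * κ := by nlinarith
  refine ⟨κ, 2 / 3 * (1 + κ), hκ2, fun x => (1 - δ) + δ * stepFun (3 - e) e x, G, C, he, he1, hκ,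
    hκ1, by linarith, by linarith, h,
    contDiff_const.add (contDiff_const.mul (contDiff_stepFun _ _)), fun x => ?_, fun x => ?_, ?_, ?_,
    fun x => ?_⟩
  · nlinarith [(stepFun_mem (3 - e) e x).1]
  · nlinarith [(stepFun_mem (3 - e) e x).2]
  · rw [stepFun_one he (by linarith)]; ring
  · rw [stepFun_zero he le_rfl, hδ]; ring
  · have h1 : HasDerivAt (fun x => (1 - δ) + δ * stepFun (3 - e) e x)
        (δ * (deriv Real.smoothTransition ((x - (3 - e)) / e) * (1 / e))) x :=
      (((hasDerivAt_of_infty Real.smoothTransition.contDiff _).comp x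
        (((hasDerivAt_id x).sub_const (3 - e)).div_const e)).const_mul δ).const_add (1 - δ)
    rw [h1.deriv, abs_mul, abs_mul, abs_of_pos hδ0, abs_of_pos (by positivity : 0 < 1 / e)]
    have h2 := hd ((x - (3 - e)) / e)
    calc Real.pi * (δ * (|deriv Real.smoothTransition ((x - (3 - e)) / e)| * (1 / e)))
        ≤ Real.pi * (4 * κ * (K * (1 / e))) := by gcongr
      _ = 8 * Real.pi * K * κ / (2 * e) := by field_simp; ring
      _ < e := by
        rw [div_lt_iff₀ (by positivity)]
        nlinarith [sq_pos_of_pos he]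

/-- The cut-offs for `reducedMap` as functions of `|ζ|²`. -/
theorem isoStages_stepFun {e : ℝ} (he : 0 < e) {b : ℝ → ℝ} (hb : ContDiff ℝ ∞ b)
    (hb0 : ∀ x, 0 < b x) : IsoStages (stepFun (3 - 7 * e) e) (stepFun (3 - 6 * e) e)
      (stepFun (3 - 5 * e) e) b where
  contDiff_one := contDiff_stepFun _ _
  contDiff_two := contDiff_stepFun _ _
  contDiff_three := contDiff_stepFun _ _
  contDiff_b := hb
  mem_one := stepFun_mem _ _
  mem_two := stepFun_mem _ _
  mem_three := stepFun_mem _ _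
  one_of_two := fun x hx => stepFun_one he (by linarith [lt_of_stepFun_ne_zero he hx])
  one_of_three := fun x hx => by
    have := le_of_mem_tsupport_stepFun he hx
    exact ⟨stepFun_one he (by linarith), stepFun_one he (by linarith)⟩
  b_pos := hb0

/-- The part of `reducedMap` that changes the modulus of `u`, with cut-offs in `|ζ|²`. -/
noncomputable def reducedIso (e m : ℝ) (b G C : ℝ → ℝ) : ℂ × ℂ → ℂ × ℂ :=
  Prod.swap ∘ isoMap (stepFun (3 - 7 * e) e) (stepFun (3 - 6 * e) e) (stepFun (3 - 5 * e) e) b G C m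
    ∘ Prod.swap

/-- The part of `reducedMap` that changes the modulus of `ζ`: it adds `e` to `|ζ|²` where
`|u|² ≥ 8/5` and `|ζ|² ≥ 3 - 2 e`, nothing where `|u|² ≤ 7/5` or `|ζ|² ≤ 3 - 3 e`. -/
noncomputable def reducedBulge (e : ℝ) : ℂ × ℂ → ℂ × ℂ :=
  polarMap (fun x => e * stepFun (7 / 5) (1 / 5) x) (stepFun (3 - 3 * e) e) 0

/-- In the coordinates of `toReduced`, the map whose image avoids the tori
`{|u|² = 1, |ζ|² = 3}` and `{|u|² = 2, |ζ|² = 3}`. -/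
noncomputable def reducedMap (e m : ℝ) (b G C : ℝ → ℝ) : ℂ × ℂ → ℂ × ℂ :=
  reducedBulge e ∘ reducedIso e m b G C

namespace ReducedData
variable {e κ m : ℝ} {b G C : ℝ → ℝ} {q : ℂ × ℂ}

theorem stages (h : ReducedData e κ m b G C) : IsoStages (stepFun (3 - 7 * e) e)
    (stepFun (3 - 6 * e) e) (stepFun (3 - 5 * e) e) b :=
  isoStages_stepFun h.e_pos h.contDiff_b fun x => by linarith [h.le_b x]

theorem one_add_κ_pos (h : ReducedData e κ m b G C) : 0 < 1 + κ := by linarith [h.κ_pos]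

theorem κ_le_B (h : ReducedData e κ m b G C) : 1 + κ ≤ 3 / 2 * (1 + 2 * κ) := by
  linarith [h.κ_pos]

theorem B_le (h : ReducedData e κ m b G C) : 3 / 2 * (1 + 2 * κ) ≤ 4 * (1 + κ) := by
  linarith [h.κ_pos]

theorem normSq_reducedIso_snd : normSq (reducedIso e m b G C q).2 = normSq q.2 := by
  simp [reducedIso, normSq_isoMap_fst]

theorem isSympAt_reducedIso (h : ReducedData e κ m b G C) (hq : normSq q.1 < 1 + κ) :
    IsSympAt (reducedIso e m b G C) q :=
  (isSympAt_swap _).comp ((isSympAt_isoMap h.profile h.stages h.one_add_κ_pos h.κ_le_B h.B_le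
    h.lt_m h.m_le (p := q.swap) hq).comp (isSympAt_swap _))

theorem injOn_reducedIso (h : ReducedData e κ m b G C) :
    Set.InjOn (reducedIso e m b G C) {q | normSq q.1 < 1 + κ} := by
  refine Set.InjOn.comp Prod.swap_injective.injOn (t := Set.univ) ?_ (Set.mapsTo_univ _ _)
  exact (injOn_isoMap h.profile h.stages h.one_add_κ_pos h.κ_le_B h.B_le h.lt_m h.m_le).comp
    Prod.swap_injective.injOn fun q hq => hq

theorem reducedIso_eq_self (h : ReducedData e κ m b G C) (hq : normSq q.2 < 3 - 7 * e) :
    reducedIso e m b G C q = q := by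
  have he := h.e_pos
  simp only [reducedIso, Function.comp_apply]
  rw [isoMap_eq_self h.profile]
  · simp
  all_goals exact stepFun_eventually_zero he (by simp only [Prod.fst_swap]; linarith)

/-- The size of the first component of `reducedIso`, on the levels that matter. -/
theorem normSq_reducedIso_fst (h : ReducedData e κ m b G C) (hq : normSq q.1 < 1 + κ) :
    normSq (reducedIso e m b G C q).1 < 11 / 5 ∧
      (normSq q.2 = 3 → 1 < normSq (reducedIso e m b G C q).1) ∧
      (normSq q.2 = 3 - e → normSq (reducedIso e m b G C q).1 < 2) := by
  obtain ⟨y, hy0, hyB, hy, hy1⟩ := exists_normSq_isoMap_snd (p := q.swap) (C := C) h.profile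
    h.stages h.one_add_κ_pos h.κ_le_B h.B_le h.lt_m h.m_le hq
  have he := h.e_pos
  have hm := h.lt_m
  change normSq (reducedIso e m b G C q).1 = _ at hy
  rw [hy]
  simp only [Prod.fst_swap] at hy1 ⊢
  have hmy : m * y < 11 / 10 := by
    have := mul_lt_mul_of_pos_left hyB (by linarith : 0 < m)
    linarith [h.b_sub, h.le_b (3 - e)]
  refine ⟨?_, fun h3 => ?_, fun h3 => ?_⟩
  · have h1 := h.b_le (normSq q.2)
    have h2 : y < 11 / 5 := by linarith [h.κ_le]
    obtain ⟨h3, h4⟩ := stepFun_mem (3 - 5 * e) e (normSq q.2)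
    rcases h3.eq_or_lt with h5 | h5
    · rw [← h5]; linarith
    · nlinarith
  · rw [stepFun_one he (by linarith)] at hy1 ⊢
    have := mul_pos (by linarith : 0 < m) (hy1 one_ne_zero)
    rw [h3, h.b_three]
    linarith
  · rw [stepFun_one he (by linarith), h3]
    have := mul_lt_mul_of_pos_left hyB (by linarith : 0 < m)
    linarith [h.b_sub]

/-- `reducedIso` turns `ζ` by an angle less than `e`, so `ζ` stays off the positive real axis. -/
theorem neg_snd_mem_slitPlane (h : ReducedData e κ m b G C) (hq : normSq q.1 < 1 + κ)
    (hq0 : q.2 ≠ 0) (hc : 3 - 4 * e < normSq q.2) (ha : |arg (-q.2)| ≤ Real.pi - e) :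
    -(reducedIso e m b G C q).2 ∈ slitPlane := by
  have he := h.e_pos
  obtain ⟨γ, hγ, h1⟩ := exists_isoMap_fst (p := q.swap) (C := C) h.profile
    h.stages h.one_add_κ_pos h.κ_le_B h.B_le h.lt_m h.m_le hq
    (stepFun_eventually_one he (by simp only [Prod.fst_swap]; linarith))
    (stepFun_eventually_one he (by simp only [Prod.fst_swap]; linarith))
    (stepFun_eventually_one he (by simp only [Prod.fst_swap]; linarith))
  change (reducedIso e m b G C q).2 = cexp (γ * I) * q.2 at h1
  have hγ' := hγ.trans_lt (h.deriv_b _)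
  have h2 := norm_mul_exp_arg_mul_I (-q.2)
  have hn : 0 < ‖-q.2‖ := by simpa using hq0
  have hlt : |γ + arg (-q.2)| < Real.pi := (abs_add_le _ _).trans_lt (by linarith)
  rw [abs_lt] at hlt
  have h3 : -(reducedIso e m b G C q).2 = (‖-q.2‖ : ℝ) * cexp ((γ + arg (-q.2) : ℝ) * I) := by
    have h4 : ((‖-q.2‖ : ℝ) : ℂ) * cexp ((γ + arg (-q.2) : ℝ) * I) =
        cexp (γ * I) * (‖-q.2‖ * cexp (arg (-q.2) * I)) := by
      push_cast
      rw [add_mul, exp_add]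
      ring
    rw [h4, h2, h1, mul_neg]
  rw [mem_slitPlane_iff_arg]
  constructor
  · rw [h3, arg_real_mul _ hn, exp_mul_I, arg_cos_add_sin_mul_I ⟨hlt.1, hlt.2.le⟩]
    exact hlt.2.ne
  · rw [h3]
    exact mul_ne_zero (by exact_mod_cast hn.ne') (Complex.exp_ne_zero _)

theorem bulge_nonneg (he : 0 < e) (X Y : ℝ) :
    0 ≤ e * stepFun (7 / 5) (1 / 5) X * stepFun (3 - 3 * e) e Y :=
  mul_nonneg (mul_nonneg he.le (stepFun_mem _ _ _).1) (stepFun_mem _ _ _).1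

theorem bulge_deriv_nonneg (he : 0 < e) (X Y : ℝ) :
    0 ≤ e * stepFun (7 / 5) (1 / 5) X * deriv (stepFun (3 - 3 * e) e) Y :=
  mul_nonneg (mul_nonneg he.le (stepFun_mem _ _ _).1) (deriv_stepFun_nonneg he _)

theorem normSq_reducedBulge_snd (he : 0 < e) (hq : q.2 ≠ 0) :
    normSq (reducedBulge e q).2 = normSq q.2 +
      e * stepFun (7 / 5) (1 / 5) (normSq q.1) * stepFun (3 - 3 * e) e (normSq q.2) := by
  have := normSq_polarMap_snd (fun x => e * stepFun (7 / 5) (1 / 5) x) (stepFun (3 - 3 * e) e) 0 hq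
    (by
      have := bulge_nonneg he (normSq q.1) (normSq q.2)
      have := normSq_pos.2 hq
      simp only [Pi.zero_apply]; linarith)
  rw [Pi.zero_apply, add_zero] at this
  exact this

theorem normSq_reducedBulge_fst : normSq (reducedBulge e q).1 = normSq q.1 :=
  normSq_polarMap_fst _ _ _ _

/-- The bulge divides `arg (-ζ)` by a number `≥ 1`, so it is injective even on the branch cut. -/
theorem injOn_reducedBulge (he : 0 < e) : Set.InjOn (reducedBulge e) {q | q.2 ≠ 0} := by
  refine injOn_polarMap (fun q hq => Or.inr ⟨hq, ?_, ?_, ?_⟩) fun X Y Y' hYY => ?_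
  · have := bulge_nonneg he (normSq q.1) (normSq q.2)
    have := normSq_pos.2 hq
    simp only [Pi.zero_apply]; linarith
  · linarith [bulge_deriv_nonneg he (normSq q.1) (normSq q.2)]
  · have h1 := bulge_deriv_nonneg he (normSq q.1) (normSq q.2)
    have h2 := neg_pi_lt_arg (-q.2)
    have h3 := arg_le_pi (-q.2)
    have hπ := Real.pi_pos
    rw [← div_eq_mul_inv, Set.mem_Ioc, lt_div_iff₀ (by linarith), div_le_iff₀ (by linarith)]
    constructor <;> nlinarith
  · simp only [Pi.zero_apply, add_zero] at hYY
    have hm : Monotone fun Y => e * stepFun (7 / 5) (1 / 5) X * stepFun (3 - 3 * e) e Y :=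
      fun Y Y' hY => mul_le_mul_of_nonneg_left (monotone_stepFun he hY)
        (mul_nonneg he.le (stepFun_mem _ _ _).1)
    rcases lt_trichotomy Y Y' with h1 | h1 | h1
    · have := hm h1.le
      simp only at this
      linarith
    · exact h1
    · have := hm h1.le
      simp only at this
      linarith

theorem reducedBulge_eq_self (he : 0 < e) (hq : normSq q.2 < 3 - 3 * e) :
    reducedBulge e q = q := by
  unfold reducedBulge polarMap
  exact polarMapOf_eq_of_eventually_zero' _ (stepFun_eventually_zero he hq)

theorem reducedMap_eq_self (h : ReducedData e κ m b G C) (hq : normSq q.2 < 3 - 7 * e) :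
    reducedMap e m b G C q = q := by
  have he := h.e_pos
  rw [reducedMap, Function.comp_apply, h.reducedIso_eq_self hq,
    reducedBulge_eq_self he (by linarith)]

theorem isSympAt_reducedMap (h : ReducedData e κ m b G C) (hq : normSq q.1 < 1 + κ)
    (hq0 : q.2 ≠ 0) (ha : |arg (-q.2)| ≤ Real.pi - e) :
    IsSympAt (reducedMap e m b G C) q := by
  have he := h.e_pos
  refine IsSympAt.comp ?_ (h.isSympAt_reducedIso hq)
  -- Below the level `3 - 3 e` the bulge is the identity; from there on `reducedIso` is complete, so
  -- the turning angle of `ζ` is controlled.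
  rcases lt_or_ge (normSq q.2) (3 - 3 * e) with hc | hc
  · exact isSympAt_polarMap_of_eventually_zero' (stepFun_eventually_zero he
      (by rwa [normSq_reducedIso_snd]))
  · refine isSympAt_polarMap (contDiff_const.mul (contDiff_stepFun _ _)) (contDiff_stepFun _ _)
      contDiff_const (h.neg_snd_mem_slitPlane hq hq0 (by linarith) ha) ?_ ?_
    · rw [normSq_reducedIso_snd]
      exact add_pos_of_pos_of_nonneg (add_pos_of_pos_of_nonneg (normSq_pos.2 hq0)
        (bulge_nonneg he _ _)) le_rfl
    · have := bulge_deriv_nonneg he (normSq (reducedIso e m b G C q).1)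
        (normSq (reducedIso e m b G C q).2)
      exact (add_pos_of_pos_of_nonneg one_pos this).ne'

theorem injOn_reducedMap (h : ReducedData e κ m b G C) :
    Set.InjOn (reducedMap e m b G C) {q | normSq q.1 < 1 + κ ∧ q.2 ≠ 0} := by
  refine (injOn_reducedBulge h.e_pos).comp (h.injOn_reducedIso.mono fun q hq => hq.1) ?_
  intro q hq
  have h1 : normSq (reducedIso e m b G C q).2 = normSq q.2 := normSq_reducedIso_snd
  have h2 := normSq_pos.2 hq.2
  rw [← h1] at h2
  exact normSq_pos.1 h2

/-- The image of `reducedMap` avoids both tori with `|ζ|² = 3`. -/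
theorem reducedMap_spec (h : ReducedData e κ m b G C) (hq : normSq q.1 < 1 + κ)
    (hq0 : q.2 ≠ 0) :
    normSq (reducedMap e m b G C q).1 < 11 / 5 ∧
      normSq q.2 ≤ normSq (reducedMap e m b G C q).2 ∧
      normSq (reducedMap e m b G C q).2 ≤ normSq q.2 + e ∧
      (normSq (reducedMap e m b G C q).2 = 3 → normSq (reducedMap e m b G C q).1 ≠ 1 ∧
        normSq (reducedMap e m b G C q).1 ≠ 2) := by
  have he := h.e_pos
  obtain ⟨h1, h2, h3⟩ := h.normSq_reducedIso_fst hq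
  have hs : normSq (reducedIso e m b G C q).2 = normSq q.2 := normSq_reducedIso_snd
  have hs0 : (reducedIso e m b G C q).2 ≠ 0 := by
    rw [← normSq_pos, hs]; exact normSq_pos.2 hq0
  have hb := normSq_reducedBulge_snd he hs0
  rw [hs] at hb
  rw [reducedMap, Function.comp_apply, normSq_reducedBulge_fst, hb]
  set x := normSq (reducedIso e m b G C q).1
  have h4 := bulge_nonneg he x (normSq q.2)
  obtain ⟨r0, r1⟩ := stepFun_mem (7 / 5) (1 / 5) x
  obtain ⟨s0, s1⟩ := stepFun_mem (3 - 3 * e) e (normSq q.2)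
  have h5 : e * stepFun (7 / 5) (1 / 5) x * stepFun (3 - 3 * e) e (normSq q.2) ≤ e * 1 * 1 := by
    gcongr
  refine ⟨h1, by linarith, by linarith, fun hc => ⟨fun hx => ?_, fun hx => ?_⟩⟩
  · -- Where `|u|² = 1` nothing is added, so the point comes from the level `3`.
    rw [stepFun_zero (by norm_num) (by rw [hx]; norm_num)] at hc
    have := h2 (by linarith)
    linarith
  · -- Where `|u|² = 2` the point comes from the level `3 - e`.
    rw [stepFun_one (by norm_num) (by rw [hx]; norm_num), mul_one] at hc
    rcases lt_or_ge (normSq q.2) (3 - 2 * e) with h6 | h6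
    · nlinarith
    · rw [stepFun_one he (by linarith)] at hc
      have := h3 (by linarith)
      linarith

end ReducedData

/-! ### The map near the sphere `|z|² + |w|² = 3` -/

/-- `reducedMap` read in the original coordinates. -/
noncomputable def liftedReducedMap (e m : ℝ) (b G C : ℝ → ℝ) : ℂ × ℂ → ℂ × ℂ :=
  ofReduced ∘ reducedMap e m b G C ∘ toReduced

/-- `liftedReducedMap` near the sphere `|z|² + |w|² = 3`, extended by the identity to the inner
ball. -/
noncomputable def levelMap (e m : ℝ) (b G C : ℝ → ℝ) (p : ℂ × ℂ) : ℂ × ℂ :=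
  if normSq p.1 + normSq p.2 < 3 - 15 / 2 * e then p else liftedReducedMap e m b G C p

/-- The set on which `levelMap` is used: near the sphere `|z|² + |w|² = 3` it is contained in
`{|z|² < 1 + κ}` and avoids a sector around the positive real `w`-axis. -/
def levelDomain (e κ : ℝ) : Set (ℂ × ℂ) :=
  {p | normSq p.1 + normSq p.2 < 3 - 8 * e ∨
    (p.2 ≠ 0 ∧ normSq p.1 < 1 + κ ∧ |arg (-p.2)| ≤ Real.pi - e)}

theorem continuous_normSq_add : Continuous fun p : ℂ × ℂ => normSq p.1 + normSq p.2 :=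
  continuous_normSq_fst.add continuous_normSq_snd

namespace ReducedData
variable {e κ m : ℝ} {b G C : ℝ → ℝ} {p : ℂ × ℂ}

theorem toReduced_snd_ne_zero (hp : p.2 ≠ 0) : (toReduced p).2 ≠ 0 := by
  rw [← normSq_pos, normSq_toReduced_snd hp]
  exact add_pos_of_nonneg_of_pos (normSq_nonneg _) (normSq_pos.2 hp)

theorem normSq_reducedMap_lt (h : ReducedData e κ m b G C) (hp : p.2 ≠ 0)
    (hX : normSq p.1 < 1 + κ) (hc : 3 - 8 * e ≤ normSq p.1 + normSq p.2) :
    normSq (reducedMap e m b G C (toReduced p)).1 <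
      normSq (reducedMap e m b G C (toReduced p)).2 := by
  have h1 := h.reducedMap_spec (q := toReduced p) (by rwa [normSq_toReduced_fst hp])
    (toReduced_snd_ne_zero hp)
  rw [normSq_toReduced_snd hp] at h1
  linarith [h1.1, h1.2.1, h.e_le]

theorem liftedReducedMap_eq_self (h : ReducedData e κ m b G C) (hp : p.2 ≠ 0)
    (hc : normSq p.1 + normSq p.2 < 3 - 7 * e) : liftedReducedMap e m b G C p = p := by
  simp only [liftedReducedMap, Function.comp_apply]
  rw [h.reducedMap_eq_self (by rwa [normSq_toReduced_snd hp]), ofReduced_toReduced hp]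

theorem isSympAt_liftedReducedMap (h : ReducedData e κ m b G C) (hp : p.2 ≠ 0)
    (hX : normSq p.1 < 1 + κ) (ha : |arg (-p.2)| ≤ Real.pi - e)
    (hc : 3 - 8 * e ≤ normSq p.1 + normSq p.2) : IsSympAt (liftedReducedMap e m b G C) p := by
  have h1 : IsSympAt (reducedMap e m b G C ∘ toReduced) p :=
    IsSympAt.comp (h.isSympAt_reducedMap (by rwa [normSq_toReduced_fst hp])
      (toReduced_snd_ne_zero hp) (by rwa [arg_neg_toReduced_snd hp])) (isSympAt_toReduced hp)
  exact IsSympAt.comp (isSympAt_ofReduced (h.normSq_reducedMap_lt hp hX hc)) h1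

theorem injOn_liftedReducedMap (h : ReducedData e κ m b G C) :
    Set.InjOn (liftedReducedMap e m b G C)
      {p | p.2 ≠ 0 ∧ normSq p.1 < 1 + κ ∧ 3 - 8 * e ≤ normSq p.1 + normSq p.2} := by
  intro p ⟨hp, hX, hc⟩ q ⟨hq, hX', hc'⟩ hpq
  have h1 := congrArg toReduced hpq
  simp only [liftedReducedMap, Function.comp_apply] at h1
  rw [toReduced_ofReduced (h.normSq_reducedMap_lt hp hX hc),
    toReduced_ofReduced (h.normSq_reducedMap_lt hq hX' hc')] at h1
  have h2 := h.injOn_reducedMap ⟨by rwa [normSq_toReduced_fst hp], toReduced_snd_ne_zero hp⟩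
    ⟨by rwa [normSq_toReduced_fst hq], toReduced_snd_ne_zero hq⟩ h1
  rw [← ofReduced_toReduced hp, h2, ofReduced_toReduced hq]

theorem liftedReducedMap_spec (h : ReducedData e κ m b G C) (hp : p.2 ≠ 0)
    (hX : normSq p.1 < 1 + κ) (hc : 3 - 8 * e ≤ normSq p.1 + normSq p.2) :
    normSq p.1 + normSq p.2 ≤ normSq (liftedReducedMap e m b G C p).1 +
        normSq (liftedReducedMap e m b G C p).2 ∧
      normSq (liftedReducedMap e m b G C p).1 + normSq (liftedReducedMap e m b G C p).2 ≤
        normSq p.1 + normSq p.2 + e ∧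
      (normSq (liftedReducedMap e m b G C p).1 + normSq (liftedReducedMap e m b G C p).2 = 3 →
        normSq (liftedReducedMap e m b G C p).1 ≠ 1 ∧
        normSq (liftedReducedMap e m b G C p).1 ≠ 2) := by
  have h1 := h.reducedMap_spec (q := toReduced p) (by rwa [normSq_toReduced_fst hp])
    (toReduced_snd_ne_zero hp)
  have h2 := h.normSq_reducedMap_lt hp hX hc
  rw [normSq_toReduced_snd hp] at h1
  have h3 : (reducedMap e m b G C (toReduced p)).2 ≠ 0 := by
    rw [← normSq_pos]; exact (normSq_nonneg _).trans_lt h2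
  simp only [liftedReducedMap, Function.comp_apply]
  rw [normSq_ofReduced_fst h3, normSq_ofReduced_snd h2, add_sub_cancel]
  exact h1.2

/-- Both formulas for `levelMap` give the identity between the levels `3 - 15/2 e` and `3 - 7 e`. -/
theorem isSympAt_levelMap (h : ReducedData e κ m b G C) (hp : p ∈ levelDomain e κ) :
    IsSympAt (levelMap e m b G C) p := by
  have he := h.e_pos
  rcases lt_or_ge (normSq p.1 + normSq p.2) (3 - 8 * e) with hc | hc
  · refine (isSympAt_id p).congr ?_
    filter_upwards [continuous_normSq_add.continuousAt.eventually_lt_const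
      (by linarith : normSq p.1 + normSq p.2 < 3 - 15 / 2 * e)] with q hq
    rw [levelMap, if_pos hq, id]
  obtain ⟨hp0, hX, ha⟩ := hp.resolve_left hc.not_gt
  rcases lt_or_ge (normSq p.1 + normSq p.2) (3 - 7 * e) with hc' | hc'
  · refine (isSympAt_id p).congr ?_
    filter_upwards [continuous_normSq_add.continuousAt.eventually_lt_const hc',
      continuous_snd.continuousAt.eventually_ne hp0] with q hq hq0
    rw [levelMap, h.liftedReducedMap_eq_self hq0 hq, ite_self, id]
  · refine (h.isSympAt_liftedReducedMap hp0 hX ha hc).congr ?_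
    filter_upwards [continuous_normSq_add.continuousAt.eventually_const_lt
      (by linarith : 3 - 15 / 2 * e < normSq p.1 + normSq p.2)] with q hq
    rw [levelMap, if_neg hq.not_gt]

theorem levelMap_cases (h : ReducedData e κ m b G C) (hp : p ∈ levelDomain e κ) :
    (normSq p.1 + normSq p.2 < 3 - 15 / 2 * e ∧ levelMap e m b G C p = p) ∨
      (3 - 15 / 2 * e ≤ normSq p.1 + normSq p.2 ∧ p.2 ≠ 0 ∧ normSq p.1 < 1 + κ ∧
        levelMap e m b G C p = liftedReducedMap e m b G C p) := by
  have he := h.e_pos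
  rcases lt_or_ge (normSq p.1 + normSq p.2) (3 - 15 / 2 * e) with hc | hc
  · exact Or.inl ⟨hc, if_pos hc⟩
  · obtain ⟨hp0, hX, -⟩ := hp.resolve_left (by linarith)
    exact Or.inr ⟨hc, hp0, hX, if_neg hc.not_gt⟩

theorem injOn_levelMap (h : ReducedData e κ m b G C) :
    Set.InjOn (levelMap e m b G C) (levelDomain e κ) := by
  have he := h.e_pos
  -- `liftedReducedMap` does not decrease `|z|² + |w|²`, so the two parts have disjoint images.
  have key : ∀ p q, normSq p.1 + normSq p.2 < 3 - 15 / 2 * e →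
      3 - 15 / 2 * e ≤ normSq q.1 + normSq q.2 → q.2 ≠ 0 → normSq q.1 < 1 + κ →
      p ≠ liftedReducedMap e m b G C q := by
    intro p q hp hq hq0 hX hpq
    have := (h.liftedReducedMap_spec hq0 hX (by linarith)).1
    rw [← hpq] at this
    linarith
  intro p hp q hq hpq
  rcases h.levelMap_cases hp with ⟨p1, p2⟩ | ⟨p1, p2, p3, p4⟩ <;>
    rcases h.levelMap_cases hq with ⟨q1, q2⟩ | ⟨q1, q2, q3, q4⟩
  · rwa [p2, q2] at hpq
  · rw [p2, q4] at hpq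
    exact absurd hpq (key _ _ p1 q1 q2 q3)
  · rw [p4, q2] at hpq
    exact absurd hpq.symm (key _ _ q1 p1 p2 p3)
  · rw [p4, q4] at hpq
    exact h.injOn_liftedReducedMap ⟨p2, p3, by linarith⟩ ⟨q2, q3, by linarith⟩ hpq

/-- `levelMap` enlarges the ball by at most `e`, and its image avoids the tori. -/
theorem levelMap_spec (h : ReducedData e κ m b G C) (hp : p ∈ levelDomain e κ)
    (h1 : normSq p.1 = 1 → 1 < normSq p.2) :
    normSq (levelMap e m b G C p).1 + normSq (levelMap e m b G C p).2 ≤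
        normSq p.1 + normSq p.2 + e ∧
      ∀ k l : ℝ, (k = 1 ∧ l = 1 ∨ k = 1 ∧ l = 2 ∨ k = 2 ∧ l = 1) →
        ¬ (normSq (levelMap e m b G C p).1 = k ∧ normSq (levelMap e m b G C p).2 = l) := by
  have he := h.e_pos
  have he1 := h.e_le
  rcases h.levelMap_cases hp with ⟨p1, p2⟩ | ⟨p1, p2, p3, p4⟩
  · rw [p2]
    refine ⟨by linarith, ?_⟩
    rintro k l (⟨rfl, rfl⟩ | ⟨rfl, rfl⟩ | ⟨rfl, rfl⟩) ⟨h2, h3⟩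
    · exact absurd (h1 h2) (by linarith)
    · rw [h2, h3] at p1
      linarith
    · rw [h2, h3] at p1
      linarith
  · rw [p4]
    obtain ⟨h2, h3, h4⟩ := h.liftedReducedMap_spec p2 p3 (by linarith)
    refine ⟨h3, ?_⟩
    rintro k l (⟨rfl, rfl⟩ | ⟨rfl, rfl⟩ | ⟨rfl, rfl⟩) ⟨h5, h6⟩
    · rw [h5, h6] at h2
      linarith
    · exact (h4 (by rw [h5, h6]; norm_num)).1 h5
    · exact (h4 (by rw [h5, h6]; norm_num)).2 h5

end ReducedData

/-! ### The map near `|z|² = 1`, and the embedding -/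

section
variable {κ : ℝ}

/-- The radii of the three cut-offs `t₁`, `t₂`, `t₃` around `|z|² = 1` are nested. -/
theorem exists_isoStages_bump (hκ : 0 < κ) : ∃ t₁ t₂ t₃ : ℝ → ℝ,
    IsoStages t₁ t₂ t₃ (fun _ => 1) ∧ t₃ 1 = 1 ∧ ∀ x, κ ≤ |x - 1| →
      t₁ =ᶠ[𝓝 x] 0 ∧ t₂ =ᶠ[𝓝 x] 0 ∧ t₃ =ᶠ[𝓝 x] 0 := by
  let f₁ : ContDiffBump (1 : ℝ) := ⟨κ / 2, 3 * κ / 4, by positivity, by linarith⟩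
  let f₂ : ContDiffBump (1 : ℝ) := ⟨κ / 4, κ / 2, by positivity, by linarith⟩
  let f₃ : ContDiffBump (1 : ℝ) := ⟨κ / 8, κ / 4, by positivity, by linarith⟩
  have hf : ∀ (f : ContDiffBump (1 : ℝ)) (x : ℝ), f.rOut < κ → κ ≤ |x - 1| →
      (f : ℝ → ℝ) =ᶠ[𝓝 x] 0 := by
    intro f x h1 h2
    rw [← notMem_tsupport_iff_eventuallyEq, f.tsupport_eq, Metric.mem_closedBall, Real.dist_eq]
    linarith
  have hle : ∀ (f g : ContDiffBump (1 : ℝ)) (x : ℝ), g.rOut ≤ f.rIn → x ∈ tsupport g →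
      f x = 1 := by
    intro f g x h1 h2
    rw [g.tsupport_eq] at h2
    exact f.one_of_mem_closedBall (Metric.closedBall_subset_closedBall h1 h2)
  refine ⟨f₁, f₂, f₃, ⟨f₁.contDiff, f₂.contDiff, f₃.contDiff, contDiff_const,
    fun x => ⟨f₁.nonneg, f₁.le_one⟩, fun x => ⟨f₂.nonneg, f₂.le_one⟩,
    fun x => ⟨f₃.nonneg, f₃.le_one⟩, fun x hx => hle f₁ f₂ x le_rfl (subset_tsupport _ hx),
    fun x hx => ⟨hle f₁ f₃ x ?_ hx, hle f₂ f₃ x le_rfl hx⟩, fun _ => one_pos⟩, ?_, fun x hx => ?_⟩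
  · change κ / 4 ≤ κ / 2
    linarith
  · exact f₃.one_of_mem_closedBall (Metric.mem_closedBall_self (by positivity))
  · refine ⟨hf _ _ ?_ hx, hf _ _ ?_ hx, hf _ _ ?_ hx⟩
    · change 3 * κ / 4 < κ; linarith
    · change κ / 2 < κ; linarith
    · change κ / 4 < κ; linarith

/-- The first map pushes the image of the ball off `{|z|² = 1, |w|² ≤ 1}`; near the sphere
`|z|² + |w|² = 3` its image lies in `{|z|² < 1 + κ}` and avoids a sector around the positive real
`w`-axis, and it enlarges the ball by less than `1 + 10 e`. -/
theorem exists_firstMap {a e : ℝ} (he : 0 < e) (he1 : e ≤ 1 / 20) (hκ : 0 < κ) (hκe : κ ≤ e)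
    (ha : 2 ≤ a) (ha3 : a ≤ 3 - 20 * e) : ∃ F : ℂ × ℂ → ℂ × ℂ,
    (∀ p, normSq p.1 + normSq p.2 < a → IsSympAt F p) ∧
      Set.InjOn F {p | normSq p.1 + normSq p.2 < a} ∧
      ∀ p, normSq p.1 + normSq p.2 < a → F p ∈ levelDomain e κ ∧
        normSq (F p).1 + normSq (F p).2 < a + 1 + 10 * e ∧
        (normSq (F p).1 = 1 → 1 < normSq (F p).2) := by
  obtain ⟨t₁, t₂, t₃, ht, h31, h0⟩ := exists_isoStages_bump hκ
  have hπ := Real.pi_gt_three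
  set A := a - 1 + κ with hA
  set B := 3 / 2 * (a - 1 + 2 * κ) with hB
  -- This `m` expands the sector to `|arg (-w)| < π - e`.
  set m := 2 * Real.pi / (3 * (Real.pi - e)) with hm
  have hA0 : 0 < A := by linarith
  have hAB : A ≤ B := by linarith
  have hBA : B ≤ 4 * A := by linarith
  have hm1 : 2 / 3 < m := by
    rw [hm, div_lt_div_iff₀ (by norm_num) (by linarith)]
    linarith
  have hm2 : m ≤ 1 := by
    rw [hm, div_le_one (by linarith)]
    linarith
  have hm3 : 3 / 2 * m ≤ 1 + e := by
    rw [hm, mul_div_assoc', div_le_iff₀ (by linarith)]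
    nlinarith
  have hm4 : 2 * Real.pi / (3 * m) = Real.pi - e := by
    have : Real.pi - e ≠ 0 := by linarith
    rw [hm]
    field_simp
  obtain ⟨G, C, hP⟩ := exists_sectorProfile (A := A) (B := B) hA0 (by linarith)
  have hnear : ∀ p : ℂ × ℂ, normSq p.1 + normSq p.2 < a → |normSq p.1 - 1| < κ →
      normSq p.2 < A := by
    intro p hp hx
    rw [abs_lt] at hx
    linarith
  have hself : ∀ p : ℂ × ℂ, κ ≤ |normSq p.1 - 1| →
      isoMap t₁ t₂ t₃ (fun _ => 1) G C m p = p := by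
    intro p hp
    obtain ⟨h1, h2, h3⟩ := h0 _ hp
    exact isoMap_eq_self hP h1 h2 h3
  refine ⟨isoMap t₁ t₂ t₃ (fun _ => 1) G C m, fun p hp => ?_, fun p hp q hq hpq => ?_,
    fun p hp => ?_⟩
  · rcases lt_or_ge |normSq p.1 - 1| κ with hx | hx
    · exact isSympAt_isoMap hP ht hA0 hAB hBA hm1 hm2 (hnear p hp hx)
    · refine (isSympAt_id p).congr ?_
      obtain ⟨h1, h2, h3⟩ := h0 _ hx
      filter_upwards [continuous_normSq_fst.continuousAt.eventually h1.eventuallyEq_nhds,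
        continuous_normSq_fst.continuousAt.eventually h2.eventuallyEq_nhds,
        continuous_normSq_fst.continuousAt.eventually h3.eventuallyEq_nhds] with q q1 q2 q3
      exact isoMap_eq_self hP q1 q2 q3
  · have hX : normSq p.1 = normSq q.1 := by
      have := congrArg (fun p : ℂ × ℂ => normSq p.1) hpq
      simpa only [normSq_isoMap_fst] using this
    rcases lt_or_ge |normSq p.1 - 1| κ with hx | hx
    · exact injOn_isoMap hP ht hA0 hAB hBA hm1 hm2 (hnear p hp hx)
        (hnear q hq (by rwa [← hX])) hpq
    · rwa [hself p hx, hself q (by rwa [← hX])] at hpq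
  · rcases lt_or_ge |normSq p.1 - 1| κ with hx | hx
    swap
    · rw [hself p hx]
      refine ⟨Or.inl (by linarith), by linarith, fun h1 => ?_⟩
      rw [h1, sub_self, abs_zero] at hx
      linarith
    have hpA := hnear p hp hx
    obtain ⟨y, hy0, hyB, hy, hy1⟩ := exists_normSq_isoMap_snd (C := C) hP ht hA0 hAB hBA hm1 hm2 hpA
    have hang := isoMap_snd_angle (C := C) hP ht hA0 hAB hBA hm1 hm2 hpA
    have hf : normSq (isoMap t₁ t₂ t₃ (fun _ => 1) G C m p).1 = normSq p.1 := normSq_isoMap_fst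
    generalize isoMap t₁ t₂ t₃ (fun _ => 1) G C m p = q at *
    rw [abs_lt] at hx
    refine ⟨?_, ?_, fun h1 => ?_⟩
    · rcases lt_or_ge (normSq q.1 + normSq q.2) (3 - 8 * e) with hc | hc
      · exact Or.inl hc
      -- Here `|w|²` is large compared with `A`, which is at most `2 - 19 e`.
      have hq2 : 2 - 9 * e < normSq q.2 := by linarith
      refine Or.inr ⟨normSq_pos.1 (by linarith), by linarith, ?_⟩
      rcases hang with h | h
      · rw [hm4] at h
        exact h.le
      · refine abs_arg_neg_le he.le (by linarith) h ?_
        have hcos := Real.one_sub_sq_div_two_le_cos (x := e)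
        have hsin := Real.sin_le he.le
        have hcs : 1 - 3 / 2 * e ≤ Real.cos e - Real.sin e := by nlinarith
        have hn : normSq q.2 = ‖q.2‖ ^ 2 := normSq_eq_norm_sq _
        have hn0 : 0 < ‖q.2‖ := by
          rw [norm_pos_iff, ← normSq_pos]; linarith
        have hle : √A < ‖q.2‖ * (1 - 3 / 2 * e) := by
          rw [Real.sqrt_lt' (mul_pos hn0 (by linarith)), mul_pow, ← hn]
          nlinarith
        exact hle.trans_le (mul_le_mul_of_nonneg_left hcs hn0.le)
    · rw [hf, hy]
      obtain ⟨t0, t1⟩ := ht.mem_three (normSq p.1)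
      have e1 : y ≤ a + 5 * e := by linarith
      have e2 : 1 + m * y ≤ a + 5 * e := by
        have : m * y ≤ m * B := mul_le_mul_of_nonneg_left hyB.le (by linarith)
        have : m * B = 3 / 2 * m * (a - 1 + 2 * κ) := by rw [hB]; ring
        have : 3 / 2 * m * (a - 1 + 2 * κ) ≤ (1 + e) * (a - 1 + 2 * κ) :=
          mul_le_mul_of_nonneg_right hm3 (by linarith)
        nlinarith
      have := mul_le_mul_of_nonneg_left e1 (sub_nonneg.2 t1)
      have := mul_le_mul_of_nonneg_left e2 t0
      linarith
    · rw [hf] at h1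
      rw [h1, h31] at hy hy1
      have := mul_pos (by linarith : 0 < m) (hy1 one_ne_zero)
      linarith

end

/-- Symplectic maps remain so under conjugation by dilations. -/
theorem IsSympAt.scale {f : ℂ × ℂ → ℂ × ℂ} {s : ℝ} (hs : s ≠ 0) {p : ℂ × ℂ}
    (h : IsSympAt f (s • p)) : IsSympAt (fun p => s⁻¹ • f (s • p)) p := by
  have h1 : HasFDerivAt (fun p => s⁻¹ • f (s • p))
      (s⁻¹ • (fderiv ℝ f (s • p)).comp (s • ContinuousLinearMap.id ℝ (ℂ × ℂ))) p :=
    (h.differentiableAt.hasFDerivAt.comp p ((hasFDerivAt_id p).const_smul s)).const_smul s⁻¹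
  have hsm : ∀ (c : ℝ) (u v : ℂ × ℂ),
      stdSymplecticForm (c • u) (c • v) = c ^ 2 * stdSymplecticForm u v := by
    intro c u v
    simp [stdSymplecticForm]
    ring
  refine ⟨(h.1.comp p (contDiffAt_id.const_smul s)).const_smul s⁻¹,
    fun u v => ?_⟩
  rw [h1.fderiv]
  simp only [smul_apply, ContinuousLinearMap.comp_apply,
    ContinuousLinearMap.id_apply]
  rw [hsm, h.2, hsm, ← mul_assoc, ← mul_pow, inv_mul_cancel₀ hs, one_pow, one_mul]

theorem proposition2 (R a : ℝ) (hR₃ : 3 < R) (hR₄ : R ≤ 4) (ha : a < R - 1) :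
    ∃ f : ℂ × ℂ → ℂ × ℂ,
      IsSymplecticEmbeddingOn f (capacityBall a)
        (capacityBall R \ (productTorus 1 1 ∪ productTorus 1 2 ∪ productTorus 2 1)) := by
  -- A larger ball may be embedded instead, as `2 < R - 1`.
  set a' := max a 2 with ha'
  have ha2 : a' < R - 1 := max_lt ha (by linarith)
  set e := (R - 1 - a') / 20 with he
  have ha2' : 2 ≤ a' := le_max_right _ _
  have he0 : 0 < e := by rw [he]; linarith
  have he1 : e ≤ 1 / 20 := by rw [he]; linarith
  obtain ⟨κ, m, hκe, b, G, C, hD⟩ := exists_reducedData he0 he1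
  obtain ⟨F, hF, hFinj, hFspec⟩ := exists_firstMap (a := a') he0 he1 hD.κ_pos hκe ha2'
    (by rw [he]; linarith)
  have hπ : 0 < √Real.pi := Real.sqrt_pos.2 Real.pi_pos
  have hπ2 : √Real.pi ^ 2 = Real.pi := Real.sq_sqrt Real.pi_pos.le
  have hsc : ∀ z : ℂ, normSq (√Real.pi • z) = Real.pi * ‖z‖ ^ 2 := fun z => by
    rw [normSq_eq_norm_sq, norm_smul, mul_pow, Real.norm_eq_abs, sq_abs, hπ2]
  have hball : ∀ p ∈ capacityBall a, normSq (√Real.pi • p).1 + normSq (√Real.pi • p).2 < a' := by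
    intro p hp
    rw [Prod.smul_fst, Prod.smul_snd, hsc, hsc, ← mul_add]
    exact lt_of_lt_of_le hp (le_max_left _ _)
  set E := levelMap e m b G C ∘ F with hE
  have hEat : ∀ p, normSq p.1 + normSq p.2 < a' → IsSympAt E p := fun p hp =>
    (hD.isSympAt_levelMap (hFspec p hp).1).comp (hF p hp)
  have hback : ∀ q : ℂ × ℂ, √Real.pi • (√Real.pi)⁻¹ • q = q := fun q =>
    smul_inv_smul₀ hπ.ne' q
  refine ⟨fun p => (√Real.pi)⁻¹ • E (√Real.pi • p),
    isSymplecticEmbeddingOn_of_isSympAt ?_ ?_ ?_ ?_⟩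
  · exact isOpen_lt (by fun_prop) continuous_const
  · exact fun p hp => (hEat _ (hball p hp)).scale hπ.ne'
  · intro p hp q hq hpq
    have h1 : E (√Real.pi • p) = E (√Real.pi • q) := smul_right_injective _ (inv_ne_zero hπ.ne') hpq
    have h2 := hFinj (hball p hp) (hball q hq) (hD.injOn_levelMap (hFspec _ (hball p hp)).1
      (hFspec _ (hball q hq)).1 h1)
    exact smul_right_injective _ hπ.ne' h2
  · intro p hp
    obtain ⟨h1, h2, h3⟩ := hFspec _ (hball p hp)
    obtain ⟨h4, h5⟩ := hD.levelMap_spec h1 h3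
    change normSq (E (√Real.pi • p)).1 + normSq (E (√Real.pi • p)).2 ≤ _ at h4
    change ∀ k l : ℝ, _ → ¬ (normSq (E (√Real.pi • p)).1 = k ∧ normSq (E (√Real.pi • p)).2 = l) at h5
    rw [← hback (E (√Real.pi • p)), Prod.smul_fst, Prod.smul_snd, hsc, hsc] at h4 h5
    refine ⟨?_, ?_⟩
    · change Real.pi * (_ + _) < R
      rw [mul_add]
      refine h4.trans_lt ?_
      rw [he] at h2 ⊢
      linarith
    · rintro ((h | h) | h)
      · exact h5 1 1 (Or.inl ⟨rfl, rfl⟩) h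
      · exact h5 1 2 (Or.inr (Or.inl ⟨rfl, rfl⟩)) h
      · exact h5 2 1 (Or.inr (Or.inr ⟨rfl, rfl⟩)) h
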